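/- Let $\mathfrak g$ be a complex simple Lie algebra (finite-dimensional) with basis $\{X_A\}$, let $B^{AB}$ be the inverse of the Killing Gram matrix $B_{AB}=\mathrm{Tr}(\mathrm{ad}_{X_A}\mathrm{ad}_{X_B})$, and let $\rho^{(1)},\rho^{(2)}:\mathfrak g\to\mathrm{End}(\mathbb C^{d})$ be faithful representations with $\rho:=\rho^{(1)}$ irreducible. Put $C^{(ij)}=B^{AB}\rho^{(i)}(X_A)\otimes\rho^{(j)}(X_B)$ (summation over $A,B$), and for a matrix $M$ write $M_1=M\otimes 1$, $M_2=1\otimes M$. Let $\kappa\in\mathrm{End}(\mathbb C^d)$ be invertible and let $D\subseteq\mathbb C\setminus\{0\}$ contain all $u$ with $|u|$ sufficiently large. Call $\tilde\kappa:D\to\mathrm{End}(\mathbb C^d)$ a solution if it satisfies the classical boundary Yang–Baxter equation $$\frac{1}{u-v}\Big(C^{(11)}\tilde\kappa_1(u)\tilde\kappa_2(v)-\tilde\kappa_1(u)\tilde\kappa_2(v)C^{(22)}\Big)+\frac{1}{u+v}\Big(\tilde\kappa_1(u)C^{(21)}\tilde\kappa_2(v)-\tilde\kappa_2(v)C^{(12)}\tilde\kappa_1(u)\Big)=0$$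 for all $u,v\in D$ with $u\neq\pm v$, has $\tilde\kappa(u)=\kappa+\mathcal O(u^{-1})$ as $u\to\infty$, and is normalized by $\mathrm{Tr}(\tilde\kappa(u)\kappa^{-1})=d$ for all $u\in D$. Assume that a solution exists. Then there is a Lie algebra automorphism $\alpha$ of $\mathfrak g$ with $\alpha^2=\mathrm{id}$ and $\rho^{(1)}(\alpha(X))=\kappa\rho^{(2)}(X)\kappa^{-1}$ for all $X\in\mathfrak g$. Let $\mathfrak h=\{X\in\mathfrak g:\alpha(X)=X\}$ and suppose that $\mathfrak h$ is reductive. If $\mathfrak h$ is not semisimple, there is a central element $X_0$ of $\mathfrak h$ with $\mathrm{Tr}(\rho(X_0)\rho(X_0))=1$. Let $X_0$ be any such element (if $\mathfrak h$ is semisimple, let $X_0=0$, the only central element). Then: 1. every solution $\tilde\kappa$ has, for some $a_0\in\mathbb C$, the asymptotic expansion $$\tilde\kappa(u)=\kappa+\frac{a_0}{u}\rho(X_0)\kappa+\mathcal O(u^{-2})\qquad(u\to\infty);$$ 2. once $a_0$ is fixed, $\tilde\kappa$ is unique: two solutions on $D$ (with the same $\kappa$) that have this expansion with the same $X_0$ and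 $a_0$ coincide on $D$. -/

import Mathlib

open scoped Kronecker

attribute [local instance] LieRing.ofAssociativeRing

noncomputable section

/-- A representation of a Lie algebra on `ℂ ^ d` is irreducible: the space is nonzero and has no
invariant subspaces besides `0` and the whole space. -/
def IsIrreducibleRep {g : Type*} [LieRing g] [LieAlgebra ℂ g] {d : ℕ}
    (ρ : g →ₗ⁅ℂ⁆ Matrix (Fin d) (Fin d) ℂ) : Prop :=
  0 < d ∧ ∀ W : Submodule ℂ (Fin d → ℂ),
    (∀ X : g, ∀ w ∈ W, (ρ X).mulVec w ∈ W) → W = ⊥ ∨ W = ⊤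

/-- The Gram matrix `B_{AB} = Tr (ad X_A ∘ ad X_B)` of the Killing form in a basis `(X_A)`. -/
def killingGram {g : Type*} [LieRing g] [LieAlgebra ℂ g] {ι : Type*}
    (b : Module.Basis ι ℂ g) : Matrix ι ι ℂ :=
  Matrix.of fun A B => killingForm ℂ g (b A) (b B)

/-- The tensor `∑ B^{AB} ρ(X_A) ⊗ σ(X_B)`, where `B^{AB}` is the inverse of the Gram matrix
of the Killing form. -/
def casimirTensor {g : Type*} [LieRing g] [LieAlgebra ℂ g] {ι : Type*} [Fintype ι] [DecidableEq ι]
    (b : Module.Basis ι ℂ g) {d : ℕ} (ρ σ : g →ₗ⁅ℂ⁆ Matrix (Fin d) (Fin d) ℂ) :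
    Matrix (Fin d × Fin d) (Fin d × Fin d) ℂ :=
  ∑ A, ∑ B, (killingGram b)⁻¹ A B • (ρ (b A) ⊗ₖ σ (b B))

/-- An operator acting on the first tensor factor. -/
def leg₁ {d : ℕ} (M : Matrix (Fin d) (Fin d) ℂ) : Matrix (Fin d × Fin d) (Fin d × Fin d) ℂ :=
  M ⊗ₖ (1 : Matrix (Fin d) (Fin d) ℂ)

/-- An operator acting on the second tensor factor. -/
def leg₂ {d : ℕ} (M : Matrix (Fin d) (Fin d) ℂ) : Matrix (Fin d × Fin d) (Fin d × Fin d) ℂ :=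
  (1 : Matrix (Fin d) (Fin d) ℂ) ⊗ₖ M

/-- `M(u) = N(u) + O(u ^ (-n))` as `u → ∞` in `ℂ`, for matrix-valued functions (all norms on
matrices being equivalent, this is stated entrywise). -/
def EqUpToOrder {d : ℕ} (n : ℕ) (M N : ℂ → Matrix (Fin d) (Fin d) ℂ) : Prop :=
  ∀ i j, (fun u => M u i j - N u i j) =O[Bornology.cobounded ℂ] fun u => (u ^ n)⁻¹

/-- The classical boundary Yang-Baxter equation for a spectral parameter dependent matrix `κt`,
at the pair `(u, v)`. -/
def ClassicalBYBE {g : Type*} [LieRing g] [LieAlgebra ℂ g] {ι : Type*} [Fintype ι] [DecidableEq ι]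
    (b : Module.Basis ι ℂ g) {d : ℕ} (ρ₁ ρ₂ : g →ₗ⁅ℂ⁆ Matrix (Fin d) (Fin d) ℂ)
    (κt : ℂ → Matrix (Fin d) (Fin d) ℂ) (u v : ℂ) : Prop :=
  (1 / (u - v)) • (casimirTensor b ρ₁ ρ₁ * leg₁ (κt u) * leg₂ (κt v)
      - leg₁ (κt u) * leg₂ (κt v) * casimirTensor b ρ₂ ρ₂)
    + (1 / (u + v)) • (leg₁ (κt u) * casimirTensor b ρ₂ ρ₁ * leg₂ (κt v)
      - leg₂ (κt v) * casimirTensor b ρ₁ ρ₂ * leg₁ (κt u)) = 0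

/-- `κt` is a normalized solution, on the domain `D`, of the classical boundary Yang-Baxter
equation with value `κ` at infinity. -/
structure IsKappaSolution {g : Type*} [LieRing g] [LieAlgebra ℂ g] {ι : Type*} [Fintype ι]
    [DecidableEq ι] (b : Module.Basis ι ℂ g) {d : ℕ}
    (ρ₁ ρ₂ : g →ₗ⁅ℂ⁆ Matrix (Fin d) (Fin d) ℂ) (κ : Matrix (Fin d) (Fin d) ℂ) (D : Set ℂ)
    (κt : ℂ → Matrix (Fin d) (Fin d) ℂ) : Prop where
  classicalBYBE : ∀ u ∈ D, ∀ v ∈ D, u ≠ v → u ≠ -v → ClassicalBYBE b ρ₁ ρ₂ κt u v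
  limit : EqUpToOrder 1 κt (fun _ => κ)
  trace_eq : ∀ u ∈ D, (κt u * κ⁻¹).trace = (d : ℂ)

/-- The expansion `κt(u) = κ + (a₀ / u) Y κ + O(u⁻²)`. -/
def HasKappaExpansion {d : ℕ} (κ Y : Matrix (Fin d) (Fin d) ℂ) (a₀ : ℂ)
    (κt : ℂ → Matrix (Fin d) (Fin d) ℂ) : Prop :=
  EqUpToOrder 2 κt (fun u => κ + (a₀ / u) • (Y * κ))

/-- The subalgebra of elements fixed by a Lie algebra automorphism. -/
def fixedSubalgebra {g : Type*} [LieRing g] [LieAlgebra ℂ g] (α : g ≃ₗ⁅ℂ⁆ g) :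
    LieSubalgebra ℂ g where
  carrier := {X | α X = X}
  zero_mem' := map_zero α
  add_mem' := by
    intro X Y hX hY
    simp only [Set.mem_ofPred_eq] at hX hY ⊢
    rw [map_add, hX, hY]
  smul_mem' := by
    intro c X hX
    simp only [Set.mem_ofPred_eq] at hX ⊢
    rw [map_smul, hX]
  lie_mem' := by
    intro X Y hX hY
    simp only [Set.mem_ofPred_eq] at hX hY
    change α ⁅X, Y⁆ = ⁅X, Y⁆
    rw [LieEquiv.map_lie, hX, hY]

end

/-! Write `A(u) = κt(u) κ⁻¹` and `σ = κ ρ₂ κ⁻¹`, so that `A(u) → 1`. Everything comes from sending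
spectral parameters to infinity and cancelling a faithful leg of the Casimir tensor, which is
legitimate because the Killing form is nondegenerate (`casimirPairing_left_injective`).

Sending both parameters to infinity leaves the Casimir tensor of `ρ + σ` and `ρ - σ` equal to zero.
Hence the kernels of `ρ + σ` and `ρ - σ` span `g`, and `σ = ρ ∘ α` for an involution `α`
(`exists_involution`). Write `g = h ⊕ m` for its eigenspaces. Sending one parameter to infinity
shows that `X ↦ [ρ(X), A(v)]` is odd under `α`, and the equation reduces to one between commutators
and anticommutators with `A` (`IsKappaSolution.isReducedSolution`).

In the reduced equation `u [ρ(X), A(u)]` is, for fixed `v`, a linear function of `A(u)`, so it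
converges. The limit is a derivation of `ρ(g)` and therefore equals `ρ ⁅X, Z⁆` with `Z` central in
`h` (`IsReducedSolution.exists_central`). Schur's lemma and the trace normalization turn this into
`A(u) = 1 + ρ(Z)/u + O(u⁻²)`.

The centre of `h` is at most a line. For central `Z`, the operator `(ad Z)²` is a scalar on `m`, by
a centroid argument using simplicity. If `Z` is Killing-isotropic, that operator is therefore zero,
and then `Z = 0`. An anisotropic quadratic form over `ℂ` lives in dimension at most one, so `Z = a₀
X₀`.

For uniqueness, the limit `u → ∞` with `Z` known makes each `A(v)` a solution of linear equations
(`IsTwistedIntertwiner`, with `t = 2v`). By irreducibility these have at most a line of solutions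
once one of them has nonzero trace (`IsTwistedIntertwiner.unique`). A kernel argument suffices
unless `t²` is the scalar of `(ad Z)²`; in that case the eigenspaces of `ad Z` give a triangular
decomposition and the argument is run on highest weight vectors. -/

open scoped Kronecker Matrix


/-! ### Casimir tensors of pairs of linear maps -/

section CasimirPairing

variable {g : Type*} [LieRing g] [LieAlgebra ℂ g] {ι : Type*} [Fintype ι] [DecidableEq ι]
  (b : Module.Basis ι ℂ g) {d : ℕ}

/-- The tensor `∑ B^{AB} F(X_A) ⊗ G(X_B)` for linear maps `F` and `G`. -/
noncomputable def casimirPairing (F G : g →ₗ[ℂ] Matrix (Fin d) (Fin d) ℂ) :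
    Matrix (Fin d × Fin d) (Fin d × Fin d) ℂ :=
  ∑ A, ∑ B, (killingGram b)⁻¹ A B • (F (b A) ⊗ₖ G (b B))

lemma casimirTensor_eq_casimirPairing (ρ σ : g →ₗ⁅ℂ⁆ Matrix (Fin d) (Fin d) ℂ) :
    casimirTensor b ρ σ = casimirPairing b (ρ : g →ₗ[ℂ] Matrix (Fin d) (Fin d) ℂ) σ := rfl

variable (F F' G G' : g →ₗ[ℂ] Matrix (Fin d) (Fin d) ℂ)

lemma casimirPairing_add_left :
    casimirPairing b (F + F') G = casimirPairing b F G + casimirPairing b F' G := by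
  simp [casimirPairing, Matrix.add_kronecker, Finset.sum_add_distrib]

lemma casimirPairing_add_right :
    casimirPairing b F (G + G') = casimirPairing b F G + casimirPairing b F G' := by
  simp [casimirPairing, Matrix.kronecker_add, Finset.sum_add_distrib]

lemma casimirPairing_smul_left (c : ℂ) :
    casimirPairing b (c • F) G = c • casimirPairing b F G := by
  simp [casimirPairing, Matrix.smul_kronecker, Finset.smul_sum, smul_comm c]

lemma casimirPairing_smul_right (c : ℂ) :
    casimirPairing b F (c • G) = c • casimirPairing b F G := by
  simp [casimirPairing, Matrix.kronecker_smul, Finset.smul_sum, smul_comm c]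

lemma casimirPairing_neg_left : casimirPairing b (-F) G = -casimirPairing b F G := by
  rw [← neg_one_smul ℂ F, casimirPairing_smul_left, neg_one_smul]

lemma casimirPairing_neg_right : casimirPairing b F (-G) = -casimirPairing b F G := by
  rw [← neg_one_smul ℂ G, casimirPairing_smul_right, neg_one_smul]

lemma casimirPairing_sub_left :
    casimirPairing b (F - F') G = casimirPairing b F G - casimirPairing b F' G := by
  rw [sub_eq_add_neg, casimirPairing_add_left, casimirPairing_neg_left, sub_eq_add_neg]

lemma casimirPairing_sub_right :
    casimirPairing b F (G - G') = casimirPairing b F G - casimirPairing b F G' := by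
  rw [sub_eq_add_neg, casimirPairing_add_right, casimirPairing_neg_right, sub_eq_add_neg]

lemma leg₁_mul_casimirPairing (M : Matrix (Fin d) (Fin d) ℂ) :
    leg₁ M * casimirPairing b F G = casimirPairing b (LinearMap.mulLeft ℂ M ∘ₗ F) G := by
  simp [casimirPairing, leg₁, Finset.mul_sum, ← Matrix.mul_kronecker_mul]

lemma leg₂_mul_casimirPairing (M : Matrix (Fin d) (Fin d) ℂ) :
    leg₂ M * casimirPairing b F G = casimirPairing b F (LinearMap.mulLeft ℂ M ∘ₗ G) := by
  simp [casimirPairing, leg₂, Finset.mul_sum, ← Matrix.mul_kronecker_mul]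

lemma casimirPairing_mul_leg₁ (M : Matrix (Fin d) (Fin d) ℂ) :
    casimirPairing b F G * leg₁ M = casimirPairing b (LinearMap.mulRight ℂ M ∘ₗ F) G := by
  simp [casimirPairing, leg₁, Finset.sum_mul, ← Matrix.mul_kronecker_mul]

lemma casimirPairing_mul_leg₂ (M : Matrix (Fin d) (Fin d) ℂ) :
    casimirPairing b F G * leg₂ M = casimirPairing b F (LinearMap.mulRight ℂ M ∘ₗ G) := by
  simp [casimirPairing, leg₂, Finset.sum_mul, ← Matrix.mul_kronecker_mul]

/-- Contraction of the second tensor factor with a linear functional. -/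
noncomputable def contractLeg₂ (φ : Matrix (Fin d) (Fin d) ℂ →ₗ[ℂ] ℂ) :
    Matrix (Fin d × Fin d) (Fin d × Fin d) ℂ →ₗ[ℂ] Matrix (Fin d) (Fin d) ℂ where
  toFun W := Matrix.of fun i j => φ (Matrix.of fun k l => W (i, k) (j, l))
  map_add' W W' := by
    ext i j
    simp only [Matrix.add_apply, Matrix.of_apply, ← map_add]
    rfl
  map_smul' c W := by
    ext i j
    simp only [Matrix.smul_apply, Matrix.of_apply, RingHom.id_apply, ← map_smul]
    rfl

lemma contractLeg₂_kronecker (φ : Matrix (Fin d) (Fin d) ℂ →ₗ[ℂ] ℂ)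
    (M N : Matrix (Fin d) (Fin d) ℂ) : contractLeg₂ φ (M ⊗ₖ N) = φ N • M := by
  ext i j
  simp only [contractLeg₂, LinearMap.coe_mk, AddHom.coe_mk, Matrix.of_apply, Matrix.smul_apply,
    Matrix.kroneckerMap_apply]
  rw [smul_eq_mul, mul_comm, ← smul_eq_mul, ← map_smul]
  rfl

lemma contractLeg₂_add (φ ψ : Matrix (Fin d) (Fin d) ℂ →ₗ[ℂ] ℂ)
    (W : Matrix (Fin d × Fin d) (Fin d × Fin d) ℂ) :
    contractLeg₂ (φ + ψ) W = contractLeg₂ φ W + contractLeg₂ ψ W := rfl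

lemma contractLeg₂_smul (c : ℂ) (φ : Matrix (Fin d) (Fin d) ℂ →ₗ[ℂ] ℂ)
    (W : Matrix (Fin d × Fin d) (Fin d × Fin d) ℂ) :
    contractLeg₂ (c • φ) W = c • contractLeg₂ φ W := rfl

lemma contractLeg₂_casimirPairing (φ : Matrix (Fin d) (Fin d) ℂ →ₗ[ℂ] ℂ) :
    contractLeg₂ φ (casimirPairing b F G) =
      F (∑ A, ∑ B, ((killingGram b)⁻¹ A B * φ (G (b B))) • b A) := by
  simp [casimirPairing, contractLeg₂_kronecker, smul_smul]

lemma killingGram_isSymm : (killingGram b).IsSymm := by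
  ext A B
  simp [killingGram, LieModule.traceForm_comm ℂ g g (b A) (b B)]

lemma killingGram_inv_comm (A B : ι) : (killingGram b)⁻¹ A B = (killingGram b)⁻¹ B A := by
  have h := congrFun (congrFun (Matrix.transpose_nonsing_inv (killingGram b)) A) B
  rw [(killingGram_isSymm b).eq] at h
  exact h.symm

/-- Exchange of the two tensor factors. -/
def swapLegs (W : Matrix (Fin d × Fin d) (Fin d × Fin d) ℂ) :
    Matrix (Fin d × Fin d) (Fin d × Fin d) ℂ := W.submatrix Prod.swap Prod.swap

lemma swapLegs_casimirPairing :
    swapLegs (casimirPairing b F G) = casimirPairing b G F := by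
  ext ⟨i, k⟩ ⟨j, l⟩
  simp only [swapLegs, casimirPairing, Matrix.submatrix_apply, Matrix.sum_apply, Matrix.smul_apply,
    Matrix.kroneckerMap_apply, Prod.swap_prod_mk]
  rw [Finset.sum_comm]
  refine Finset.sum_congr rfl fun A _ => Finset.sum_congr rfl fun B _ => ?_
  rw [killingGram_inv_comm b B A, mul_comm (F (b B) k l)]

variable [LieAlgebra.IsKilling ℂ g]

lemma isUnit_killingGram_det : IsUnit (killingGram b).det := by
  have : Module.Finite ℂ g := Module.Finite.of_basis b
  have h : killingGram b = LinearMap.BilinForm.toMatrix b (killingForm ℂ g) := by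
    ext A B
    simp [killingGram, LinearMap.BilinForm.toMatrix_apply]
  rw [h, isUnit_iff_ne_zero]
  exact (LinearMap.BilinForm.nondegenerate_iff_det_ne_zero b).1
    (LieAlgebra.IsKilling.killingForm_nondegenerate ℂ g)

lemma sum_killingGram_inv_smul (X : g) :
    ∑ A, ∑ B, ((killingGram b)⁻¹ A B * killingForm ℂ g X (b B)) • b A = X := by
  conv_rhs => rw [← b.sum_repr X]
  refine Finset.sum_congr rfl fun A _ => ?_
  rw [← Finset.sum_smul]
  congr 1
  have h1 : ∀ B, killingForm ℂ g X (b B) = ∑ C, killingGram b B C * b.repr X C := by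
    intro B
    conv_lhs => rw [← b.sum_repr X]
    simp only [map_sum, LinearMap.sum_apply, map_smul, LinearMap.smul_apply, smul_eq_mul]
    refine Finset.sum_congr rfl fun C _ => ?_
    rw [mul_comm, LieModule.traceForm_comm]
    rfl
  have h2 : (killingGram b)⁻¹ *ᵥ (killingGram b *ᵥ (b.repr X)) = b.repr X := by
    rw [Matrix.mulVec_mulVec, Matrix.nonsing_inv_mul _ (isUnit_killingGram_det b),
      Matrix.one_mulVec]
  rw [← congrFun h2 A]
  simp only [h1, Matrix.mulVec, dotProduct]

variable {F F' G G'}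

lemma contractLeg₂_casimirPairing_of_eq {φ : Matrix (Fin d) (Fin d) ℂ →ₗ[ℂ] ℂ} {X : g}
    (h : ∀ Y, φ (G Y) = killingForm ℂ g X Y) : contractLeg₂ φ (casimirPairing b F G) = F X := by
  rw [contractLeg₂_casimirPairing]
  simp only [h, sum_killingGram_inv_smul]

/-- Supplies the functional whose contraction with the second leg evaluates the first leg at `X`. -/
lemma exists_functional_of_injective (hG : Function.Injective G) (X : g) :
    ∃ φ : Matrix (Fin d) (Fin d) ℂ →ₗ[ℂ] ℂ, ∀ Y, φ (G Y) = killingForm ℂ g X Y := by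
  obtain ⟨l, hl⟩ := LinearMap.exists_leftInverse_of_injective G (LinearMap.ker_eq_bot.2 hG)
  refine ⟨killingForm ℂ g X ∘ₗ l, fun Y => ?_⟩
  have := LinearMap.congr_fun hl Y
  simp only [LinearMap.comp_apply, LinearMap.id_apply] at this ⊢
  rw [this]

lemma casimirPairing_left_injective (hG : Function.Injective G)
    (h : casimirPairing b F G = casimirPairing b F' G) : F = F' := by
  ext1 X
  obtain ⟨φ, hφ⟩ := exists_functional_of_injective hG X
  rw [← contractLeg₂_casimirPairing_of_eq b (F := F) hφ, h,
    contractLeg₂_casimirPairing_of_eq b hφ]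

lemma casimirPairing_right_injective (hF : Function.Injective F)
    (h : casimirPairing b F G = casimirPairing b F G') : G = G' := by
  refine casimirPairing_left_injective b hF ?_
  rw [← swapLegs_casimirPairing, h, swapLegs_casimirPairing]

/-- Moving a linear map to its adjoint for the Killing form. -/
lemma casimirPairing_comp_left (S S' : g →ₗ[ℂ] g)
    (h : ∀ X Y, killingForm ℂ g (S X) Y = killingForm ℂ g X (S' Y)) :
    casimirPairing b (F ∘ₗ S) G = casimirPairing b F (G ∘ₗ S') := by
  -- The Killing-dual basis: the tensor becomes a single sum over pairs of dual basis vectors.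
  let e : ι → g := fun B => ∑ A, (killingGram b)⁻¹ A B • b A
  have hF : ∀ F G : g →ₗ[ℂ] Matrix (Fin d) (Fin d) ℂ,
      casimirPairing b F G = ∑ B, F (e B) ⊗ₖ G (b B) := by
    intro F G
    rw [casimirPairing, Finset.sum_comm]
    refine Finset.sum_congr rfl fun B _ => ?_
    ext ⟨i, k⟩ ⟨j, l⟩
    simp [e, Matrix.sum_apply, Finset.sum_mul, mul_assoc]
  have he : ∀ Y, ∑ B, killingForm ℂ g (e B) Y • b B = Y := by
    intro Y
    conv_rhs => rw [← sum_killingGram_inv_smul b Y]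
    refine Finset.sum_congr rfl fun B _ => ?_
    simp only [e, map_sum, LinearMap.sum_apply, map_smul, LinearMap.smul_apply, smul_eq_mul,
      Finset.sum_smul]
    refine Finset.sum_congr rfl fun A _ => ?_
    rw [killingGram_inv_comm b A B, LieModule.traceForm_comm]
  have hS : ∀ B, S (e B) =
      ∑ A, ∑ C, ((killingGram b)⁻¹ A C * killingForm ℂ g (e B) (S' (b C))) • b A := by
    intro B
    conv_lhs => rw [← sum_killingGram_inv_smul b (S (e B))]
    simp only [h]
  have hS' : ∀ C, G (S' (b C)) = ∑ B, killingForm ℂ g (e B) (S' (b C)) • G (b B) := by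
    intro C
    conv_lhs => rw [← he (S' (b C))]
    simp
  rw [hF]
  simp only [casimirPairing, LinearMap.comp_apply, hS, hS']
  ext ⟨i, k⟩ ⟨j, l⟩
  simp only [map_sum, map_smul, Matrix.sum_apply, Matrix.smul_apply, Matrix.kroneckerMap_apply,
    Finset.sum_mul, Finset.mul_sum, smul_eq_mul]
  rw [Finset.sum_comm]
  refine Finset.sum_congr rfl fun A _ => ?_
  rw [Finset.sum_comm]
  refine Finset.sum_congr rfl fun C _ => Finset.sum_congr rfl fun B _ => ?_
  ring

end CasimirPairing

/-! ### Symmetric pairs and the centre of the fixed subalgebra -/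

section SymmetricPair

variable {g : Type*} [LieRing g] [LieAlgebra ℂ g] (α : g ≃ₗ⁅ℂ⁆ g)

/-- The symmetric and antisymmetric parts of an element with respect to an involution. -/
lemma exists_fixed_add_anti (hα : ∀ X, α (α X) = X) (X : g) :
    ∃ y a, α y = y ∧ α a = -a ∧ X = y + a := by
  refine ⟨(1 / 2 : ℂ) • (X + α X), (1 / 2 : ℂ) • (X - α X), ?_, ?_, ?_⟩
  · rw [map_smul, map_add, hα, add_comm]
  · rw [map_smul, map_sub, hα, ← smul_neg, neg_sub]
  · module

/-- Apply Jacobi with `M` inserted at each of the three places, together with `M` of Jacobi. By `h2`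
and `h3` the terms agree up to position, and half of first plus second minus third minus fourth is
the claim. -/
lemma lie_triple_centroid {α : g ≃ₗ⁅ℂ⁆ g} (M : g →ₗ[ℂ] g)
    (h2 : ∀ y a, α y = y → α a = -a → M ⁅y, a⁆ = ⁅y, M a⁆)
    (h3 : ∀ a b, α a = -a → α b = -b → ⁅M a, b⁆ = ⁅a, M b⁆)
    {a b c : g} (ha : α a = -a) (hb : α b = -b) (hc : α c = -c) :
    ⁅⁅M a, b⁆, c⁆ = M ⁅⁅a, b⁆, c⁆ := by
  have jac : ∀ x y z : g, ⁅⁅x, y⁆, z⁆ + ⁅⁅y, z⁆, x⁆ + ⁅⁅z, x⁆, y⁆ = 0 := by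
    intro x y z
    have := lie_jacobi x y z
    rw [← lie_skew ⁅x, y⁆ z, ← lie_skew ⁅y, z⁆ x, ← lie_skew ⁅z, x⁆ y, ← neg_add, ← neg_add,
      neg_eq_zero, ← this]
    abel
  have hh : ∀ x y, α x = -x → α y = -y → α ⁅x, y⁆ = ⁅x, y⁆ := by
    intro x y hx hy
    rw [LieEquiv.map_lie, hx, hy, neg_lie, lie_neg, neg_neg]
  have e1 := jac (M a) b c
  have e2 := jac a (M b) c
  have e3 := jac a b (M c)
  have e4 := congrArg M (jac a b c)
  rw [← h2 _ _ (hh b c hb hc) ha, ← h3 c a hc ha] at e1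
  rw [← h3 a b ha hb, ← h2 _ _ (hh c a hc ha) hb] at e2
  rw [← h2 _ _ (hh a b ha hb) hc, ← h3 b c hb hc] at e3
  simp only [map_add, map_zero] at e4
  linear_combination (norm := module) (1 / 2 : ℂ) • e1 + (1 / 2 : ℂ) • e2 - (1 / 2 : ℂ) • e3
    - (1 / 2 : ℂ) • e4

/-- An element of the centroid of a symmetric pair with a simple Lie algebra vanishes as soon as
it has a kernel. -/
lemma centroid_eq_zero [LieAlgebra.IsSimple ℂ g] [Module.Finite ℂ g] {α : g ≃ₗ⁅ℂ⁆ g}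
    (hα : ∀ X, α (α X) = X) (M : g →ₗ[ℂ] g)
    (h1 : ∀ a, α a = -a → α (M a) = -M a)
    (h2 : ∀ y a, α y = y → α a = -a → M ⁅y, a⁆ = ⁅y, M a⁆)
    (h3 : ∀ a b, α a = -a → α b = -b → ⁅M a, b⁆ = ⁅a, M b⁆)
    (hker : ∃ a, a ≠ 0 ∧ α a = -a ∧ M a = 0) {a : g} (ha : α a = -a) : M a = 0 := by
  let m : Submodule ℂ g := LinearMap.ker ((α : g →ₗ[ℂ] g) + LinearMap.id)
  have hm : ∀ x, x ∈ m ↔ α x = -x := by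
    intro x
    simp only [m, LinearMap.mem_ker, LinearMap.add_apply, LinearMap.id_apply]
    exact eq_neg_iff_add_eq_zero.symm
  let Mm : Submodule ℂ g := m.map M
  have hMm : ∀ x, x ∈ Mm → α x = -x := by
    rintro _ ⟨x, hx, rfl⟩
    exact h1 x ((hm x).1 hx)
  have hlie : ∀ y x, α y = y → x ∈ Mm → ⁅y, x⁆ ∈ Mm := by
    rintro y _ hy ⟨x, hx, rfl⟩
    refine ⟨⁅y, x⁆, (hm _).2 ?_, h2 y x hy ((hm x).1 hx)⟩
    rw [LieEquiv.map_lie, hy, (hm x).1 hx, lie_neg]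
  have hfix : ∀ x y, α x = -x → α y = -y → α ⁅x, y⁆ = ⁅x, y⁆ := by
    intro x y hx hy
    rw [LieEquiv.map_lie, hx, hy, neg_lie, lie_neg, neg_neg]
  have hanti : ∀ x y, α x = x → α y = -y → α ⁅x, y⁆ = -⁅x, y⁆ := by
    intro x y hx hy
    rw [LieEquiv.map_lie, hx, hy, lie_neg]
  -- With `m` the odd part, the candidate ideal is `M m` together with those `y` in the fixed part
  -- for which `⁅y, m⁆ ⊆ M m`.
  let S : Submodule ℂ g :=
    { carrier := {x | ∃ y z, α y = y ∧ z ∈ Mm ∧ x = y + z ∧ ∀ c, α c = -c → ⁅y, c⁆ ∈ Mm}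
      zero_mem' := ⟨0, 0, by simp, Mm.zero_mem, by simp, by simp⟩
      add_mem' := by
        rintro _ _ ⟨y, z, hy, hz, rfl, h⟩ ⟨y', z', hy', hz', rfl, h'⟩
        refine ⟨y + y', z + z', by rw [map_add, hy, hy'], Mm.add_mem hz hz', by abel,
          fun c hc => ?_⟩
        rw [add_lie]
        exact Mm.add_mem (h c hc) (h' c hc)
      smul_mem' := by
        rintro t _ ⟨y, z, hy, hz, rfl, h⟩
        refine ⟨t • y, t • z, by rw [map_smul, hy], Mm.smul_mem t hz, smul_add t y z,
          fun c hc => ?_⟩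
        rw [smul_lie]
        exact Mm.smul_mem t (h c hc) }
  let I : LieIdeal ℂ g :=
    { S with
      lie_mem := by
        rintro x _ ⟨y, z, hy, hz, rfl, h⟩
        obtain ⟨u, v, hu, hv, rfl⟩ := exists_fixed_add_anti α hα x
        obtain ⟨w, hw, rfl⟩ := hz
        refine ⟨⁅u, y⁆ + ⁅v, M w⁆, ⁅u, M w⁆ + ⁅v, y⁆, ?_, ?_, ?_, ?_⟩
        · rw [map_add, LieEquiv.map_lie, hu, hy, hfix v _ hv (h1 w ((hm w).1 hw))]
        · refine Mm.add_mem (hlie _ _ hu ⟨w, hw, rfl⟩) ?_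
          rw [← lie_skew]
          exact Mm.neg_mem (h v hv)
        · simp only [lie_add, add_lie]; abel
        · intro c hc
          rw [add_lie, lie_lie]
          refine Mm.add_mem (Mm.sub_mem (hlie _ _ hu (h c hc)) (h _ (hanti u c hu hc))) ?_
          -- The delicate case: the bracket of `m` with `M m` lies in the fixed part, and the triple
          -- identity shows that it sends `m` into `M m`.
          rw [← h3 v w hv ((hm w).1 hw), lie_triple_centroid M h2 h3 hv ((hm w).1 hw) hc]
          exact ⟨_, (hm _).2 (hanti _ _ (hfix v w hv ((hm w).1 hw)) hc), rfl⟩ }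
  have hI : ∀ x, x ∈ I ↔ ∃ y z, α y = y ∧ z ∈ Mm ∧ x = y + z ∧ ∀ c, α c = -c → ⁅y, c⁆ ∈ Mm :=
    fun x => Iff.rfl
  rcases LieAlgebra.IsSimple.eq_bot_or_eq_top (R := ℂ) I with h | h
  · have : M a ∈ I := (hI _).2 ⟨0, M a, by simp, ⟨a, (hm a).2 ha, rfl⟩, by simp, by simp⟩
    rwa [h, LieSubmodule.mem_bot] at this
  · exfalso
    -- If the ideal is everything, `M` is onto `m`, hence injective there by finite dimension,
    -- contradicting the kernel vector.
    let Mr : m →ₗ[ℂ] m := M.restrict fun x hx => (hm _).2 (h1 x ((hm x).1 hx))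
    have hsurj : Function.Surjective Mr := by
      rintro ⟨x, hx⟩
      have hxI : x ∈ I := by rw [h]; exact LieSubmodule.mem_top x
      obtain ⟨y, z, hy, hz, rfl, -⟩ := (hI x).1 hxI
      have hy0 : y = 0 := by
        have h1 := (hm _).1 hx
        rw [map_add, hy, hMm z hz, neg_add, add_left_inj] at h1
        have h2 : (2 : ℂ) • y = 0 := by
          rw [two_smul]; nth_rewrite 1 [h1]; simp
        simpa using h2
      obtain ⟨w, hw, rfl⟩ := hz
      exact ⟨⟨w, hw⟩, Subtype.ext (by simp [Mr, hy0])⟩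
    have hinj := LinearMap.injective_iff_surjective.2 hsurj
    obtain ⟨k, hk0, hk, hMk⟩ := hker
    have := hinj (a₁ := ⟨k, (hm k).2 hk⟩) (a₂ := 0) (Subtype.ext (by simp [Mr, hMk]))
    exact hk0 (congrArg Subtype.val this)

/-- The square of the adjoint action of a central element of the fixed subalgebra is a scalar on
the antisymmetric part. -/
lemma exists_lie_lie_eq_smul [LieAlgebra.IsSimple ℂ g] [Module.Finite ℂ g] {α : g ≃ₗ⁅ℂ⁆ g}
    (hα : ∀ X, α (α X) = X) {Z : g} (hZ : α Z = Z) (hc : ∀ y, α y = y → ⁅Z, y⁆ = 0) :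
    ∃ l : ℂ, ∀ a, α a = -a → ⁅Z, ⁅Z, a⁆⁆ = l • a := by
  let m : Submodule ℂ g := LinearMap.ker ((α : g →ₗ[ℂ] g) + LinearMap.id)
  have hm : ∀ x, x ∈ m ↔ α x = -x := by
    intro x
    simp only [m, LinearMap.mem_ker, LinearMap.add_apply, LinearMap.id_apply]
    exact eq_neg_iff_add_eq_zero.symm
  by_cases hbot : m = ⊥
  · refine ⟨0, fun a ha => ?_⟩
    have : a ∈ m := (hm a).2 ha
    rw [hbot, Submodule.mem_bot] at this
    simp [this]
  have : Nontrivial m := Submodule.nontrivial_iff_ne_bot.2 hbot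
  let S : g →ₗ[ℂ] g := (LieAlgebra.ad ℂ g Z : g →ₗ[ℂ] g) ∘ₗ LieAlgebra.ad ℂ g Z
  have hS : ∀ x, S x = ⁅Z, ⁅Z, x⁆⁆ := fun x => rfl
  have hanti : ∀ x y, α x = x → α y = -y → α ⁅x, y⁆ = -⁅x, y⁆ := by
    intro x y hx hy
    rw [LieEquiv.map_lie, hx, hy, lie_neg]
  have hSm : ∀ x ∈ m, S x ∈ m := fun x hx =>
    (hm _).2 (hanti _ _ hZ (hanti _ _ hZ ((hm x).1 hx)))
  have hcomm : ∀ y x : g, α y = y → ⁅Z, ⁅y, x⁆⁆ = ⁅y, ⁅Z, x⁆⁆ := by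
    intro y x hy
    rw [leibniz_lie, hc y hy, zero_lie, zero_add]
  -- Brackets of odd elements are fixed, hence killed by `ad Z`. So `ad Z` is skew for the bracket
  -- on the odd part, and its square is symmetric, as `centroid_eq_zero` demands.
  have hmove : ∀ a b, α a = -a → α b = -b → ⁅⁅Z, a⁆, b⁆ = -⁅a, ⁅Z, b⁆⁆ := by
    intro a b ha hb
    have : ⁅Z, ⁅a, b⁆⁆ = 0 := hc _ (by rw [LieEquiv.map_lie, ha, hb, neg_lie, lie_neg, neg_neg])
    rw [leibniz_lie] at this
    exact eq_neg_of_add_eq_zero_left this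
  obtain ⟨l, hl⟩ := Module.End.exists_eigenvalue (S.restrict hSm)
  obtain ⟨⟨k, hkm⟩, hk⟩ := hl.exists_hasEigenvector
  refine ⟨l, fun a ha => ?_⟩
  rw [← sub_eq_zero]
  refine centroid_eq_zero hα (S - l • LinearMap.id) ?_ ?_ ?_ ⟨k, ?_, (hm k).1 hkm, ?_⟩ ha
  · intro a ha
    have := (hm _).1 (hSm a ((hm a).2 ha))
    simp [this, ha]
    abel
  · intro y a hy ha
    simp [hS, hcomm y _ hy]
  · intro a b ha hb
    simp only [LinearMap.sub_apply, hS, LinearMap.smul_apply, LinearMap.id_apply, sub_lie, lie_sub,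
      smul_lie, lie_smul]
    rw [hmove _ _ (hanti _ _ hZ ha) hb, hmove _ _ ha (hanti _ _ hZ hb), neg_neg]
  · rintro rfl
    exact hk.2 rfl
  · have := congrArg Subtype.val hk.apply_eq_smul
    simp only [LinearMap.coe_restrict_apply, SetLike.val_smul] at this
    simp [this]

variable [LieAlgebra.IsKilling ℂ g] [Module.Finite ℂ g] {α : g ≃ₗ⁅ℂ⁆ g}

lemma eq_zero_of_forall_killingForm_eq_zero {Z : g} (h : ∀ X, killingForm ℂ g Z X = 0) :
    Z = 0 := by
  have : Z ∈ LinearMap.ker (killingForm ℂ g) := LinearMap.mem_ker.2 (LinearMap.ext h)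
  rwa [LieAlgebra.IsKilling.ker_killingForm_eq_bot] at this

/-- A central element of the fixed subalgebra which is ad-nilpotent vanishes. -/
lemma eq_zero_of_isNilpotent_ad (hα : ∀ X, α (α X) = X) {Z : g} (hZ : α Z = Z)
    (hc : ∀ y, α y = y → ⁅Z, y⁆ = 0) (hn : IsNilpotent (LieAlgebra.ad ℂ g Z)) : Z = 0 := by
  refine eq_zero_of_forall_killingForm_eq_zero fun X => ?_
  -- Against the fixed part, `ad Z` and `ad y` commute, so their product is nilpotent and has trace
  -- zero. Against the odd part, use that `α` is a Killing isometry.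
  obtain ⟨y, a, hy, ha, rfl⟩ := exists_fixed_add_anti α hα X
  have h1 : killingForm ℂ g Z y = 0 := by
    rw [killingForm_apply_apply]
    refine (LinearMap.isNilpotent_trace_of_isNilpotent (Commute.isNilpotent_mul_right ?_ hn)).eq_zero
    change _ * _ = _ * _
    rw [← sub_eq_zero, ← LieRing.of_associative_ring_bracket, ← LieHom.map_lie, hc y hy, map_zero]
  have h2 : killingForm ℂ g Z a = 0 := by
    have h := LieAlgebra.killingForm_of_equiv_apply α Z a
    rw [hZ, ha, map_neg] at h
    exact self_eq_neg.1 h.symm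
  rw [map_add, h1, h2, add_zero]

/-- The Killing form is anisotropic on the center of the fixed subalgebra. -/
lemma eq_zero_of_killingForm_self_eq_zero [LieAlgebra.IsSimple ℂ g]
    (hα : ∀ X, α (α X) = X) {Z : g} (hZ : α Z = Z)
    (hc : ∀ y, α y = y → ⁅Z, y⁆ = 0) (h : killingForm ℂ g Z Z = 0) : Z = 0 := by
  refine eq_zero_of_isNilpotent_ad hα hZ hc ⟨2, ?_⟩
  obtain ⟨l, hl⟩ := exists_lie_lie_eq_smul hα hZ hc
  let m : Submodule ℂ g := LinearMap.ker ((α : g →ₗ[ℂ] g) + LinearMap.id)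
  have hm : ∀ x, x ∈ m ↔ α x = -x := by
    intro x
    simp only [m, LinearMap.mem_ker, LinearMap.add_apply, LinearMap.id_apply]
    exact eq_neg_iff_add_eq_zero.symm
  let P : g →ₗ[ℂ] g := (1 / 2 : ℂ) • (LinearMap.id - (α : g →ₗ[ℂ] g))
  have hP' : ∀ x, P x = (1 / 2 : ℂ) • (x - α x) := fun x => rfl
  have hP : LinearMap.IsProj m P := by
    refine ⟨fun x => (hm _).2 ?_, fun x hx => ?_⟩
    · rw [hP', map_smul, map_sub, hα, ← smul_neg, neg_sub]
    · rw [hP', (hm x).1 hx]; module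
  have hsq : LieAlgebra.ad ℂ g Z ^ 2 = l • P := by
    ext x
    obtain ⟨y, a, hy, ha, rfl⟩ := exists_fixed_add_anti α hα x
    simp only [pow_two, Module.End.mul_apply, LieAlgebra.ad_apply, LinearMap.smul_apply, hP',
      hc y hy, map_add, hy, ha, hl a ha, lie_zero]
    module
  -- Traces in `(ad Z)² = l P`, where `P` projects onto the odd part: the left side gives the
  -- Killing norm of `Z`.
  have ht : l * (Module.finrank ℂ m : ℂ) = 0 := by
    rw [← hP.trace, ← smul_eq_mul, ← map_smul, ← hsq, pow_two, ← h]
    rfl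
  rw [hsq]
  rcases mul_eq_zero.1 ht with h0 | h0
  · rw [h0, zero_smul]
  · have hbot : m = ⊥ := Submodule.finrank_eq_zero.1 (by exact_mod_cast h0)
    have : P = 0 := by
      ext x
      have := hP.map_mem x
      rwa [hbot, Submodule.mem_bot] at this
    rw [this, smul_zero]

end SymmetricPair

/-! ### Trace forms of faithful representations -/

section TraceForm

variable {g : Type*} [LieRing g] [LieAlgebra ℂ g] [LieAlgebra.IsSimple ℂ g] [Module.Finite ℂ g]

lemma derivedSeries_one_eq_top_of_isSimple : LieAlgebra.derivedSeries ℂ g 1 = ⊤ := by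
  refine (LieAlgebra.IsSimple.eq_bot_or_eq_top (R := ℂ) _).resolve_left fun h => ?_
  refine LieAlgebra.IsSimple.non_abelian (R := ℂ) (L := g) ⟨fun x y => ?_⟩
  have hxy : ⁅x, y⁆ ∈ LieAlgebra.derivedSeries ℂ g 1 := by
    rw [LieAlgebra.derivedSeries_def, LieAlgebra.derivedSeriesOfIdeal_succ,
      LieAlgebra.derivedSeriesOfIdeal_zero]
    exact LieSubmodule.lie_mem_lie (LieSubmodule.mem_top x) (LieSubmodule.mem_top y)
  rwa [h, LieSubmodule.mem_bot] at hxy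

lemma exists_killingForm_self_ne_zero [LieAlgebra.IsKilling ℂ g] :
    ∃ X : g, killingForm ℂ g X X ≠ 0 := by
  by_contra! h
  have h0 : ∀ X Y : g, killingForm ℂ g X Y = 0 := by
    intro X Y
    have := h (X + Y)
    simp only [map_add, LinearMap.add_apply, h, LieModule.traceForm_comm ℂ g g Y X] at this
    simpa using this
  refine LieAlgebra.IsSimple.non_abelian (R := ℂ) (L := g) ⟨fun x y => ?_⟩
  exact eq_zero_of_forall_killingForm_eq_zero (h0 _)

lemma isNilpotent_ad_of_isNilpotent_map {R : Type*} [Ring R] [Algebra ℂ R] (ρ : g →ₗ⁅ℂ⁆ R)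
    (hρ : Function.Injective ρ) {X : g} (h : IsNilpotent (ρ X)) :
    IsNilpotent (LieAlgebra.ad ℂ g X) := by
  obtain ⟨n, hn⟩ := LieAlgebra.ad_nilpotent_of_nilpotent (R := ℂ) h
  refine ⟨n, LinearMap.ext fun Y => hρ ?_⟩
  have : ∀ k : ℕ, ρ ((LieAlgebra.ad ℂ g X ^ k) Y) = (LieAlgebra.ad ℂ R (ρ X) ^ k) (ρ Y) := by
    intro k
    induction k with
    | zero => simp
    | succ k ih =>
      rw [pow_succ', pow_succ', Module.End.mul_apply, Module.End.mul_apply, ← ih]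
      simp
  rw [this, hn]
  simp

/-- The trace form of a faithful representation of a simple Lie algebra is a nonzero multiple of
the Killing form. -/
lemma exists_trace_mul_eq_smul_killingForm {d : ℕ} (ρ : g →ₗ⁅ℂ⁆ Matrix (Fin d) (Fin d) ℂ)
    (hρ : Function.Injective ρ) :
    ∃ c : ℂ, c ≠ 0 ∧ ∀ X Y, (ρ X * ρ Y).trace = c * killingForm ℂ g X Y := by
  let f : g →ₗ⁅ℂ⁆ Module.End ℂ (Fin d → ℂ) :=
    ((lieEquivMatrix' (R := ℂ) (n := Fin d)).symm : _ →ₗ⁅ℂ⁆ _).comp ρ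
  let _ : LieRingModule g (Fin d → ℂ) := LieRingModule.compLieHom (Fin d → ℂ) f
  let _ : LieModule ℂ g (Fin d → ℂ) := LieModule.compLieHom (Fin d → ℂ) f
  have hf : ∀ X, LieModule.toEnd ℂ g (Fin d → ℂ) X = Matrix.toLin' (ρ X) := fun X => rfl
  have hτ : ∀ X Y, LieModule.traceForm ℂ g (Fin d → ℂ) X Y = (ρ X * ρ Y).trace := by
    intro X Y
    rw [LieModule.traceForm_apply_apply, hf, hf, ← Matrix.toLin'_mul, Matrix.trace_toLin'_eq]
  simp only [← hτ]
  set τ := LieModule.traceForm ℂ g (Fin d → ℂ)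
  have hnd := LieAlgebra.IsKilling.killingForm_nondegenerate ℂ g
  -- The trace form written through the Killing form. For an eigenvalue `c` of `T`, the radical of
  -- `τ - c • killingForm` is a nonzero ideal, hence all of `g`.
  let T : g →ₗ[ℂ] g := (LinearMap.BilinForm.toDual (killingForm ℂ g) hnd).symm ∘ₗ τ
  have hT : ∀ X Y, killingForm ℂ g (T X) Y = τ X Y := fun X Y =>
    LinearMap.BilinForm.apply_toDual_symm_apply (hB := hnd) (τ X) Y
  obtain ⟨X₁, hX₁⟩ := exists_killingForm_self_ne_zero (g := g)
  have : Nontrivial g := ⟨X₁, 0, by rintro rfl; simp at hX₁⟩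
  obtain ⟨c, hc⟩ := Module.End.exists_eigenvalue T
  obtain ⟨k, hk⟩ := hc.exists_hasEigenvector
  let I : LieIdeal ℂ g :=
    { LinearMap.ker (τ - c • killingForm ℂ g) with
      lie_mem := by
        intro X x hx
        have hx' : ∀ Y, τ x Y - c • killingForm ℂ g x Y = 0 := LinearMap.congr_fun hx
        refine LinearMap.mem_ker.2 (LinearMap.ext fun Y => ?_)
        have := hx' ⁅X, Y⁆
        rw [← LieModule.traceForm_apply_lie_apply, ← LieModule.traceForm_apply_lie_apply] at this
        rw [← lie_skew, map_neg, LinearMap.neg_apply]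
        exact neg_eq_zero.2 this }
  have hI : ∀ x, x ∈ I ↔ ∀ Y, τ x Y = c * killingForm ℂ g x Y := fun x =>
    ⟨fun h Y => sub_eq_zero.1 (LinearMap.congr_fun h Y),
      fun h => LinearMap.ext fun Y => sub_eq_zero.2 (h Y)⟩
  have hIt : I = ⊤ := by
    refine (LieAlgebra.IsSimple.eq_bot_or_eq_top (R := ℂ) I).resolve_left fun h => ?_
    have : k ∈ I := (hI k).2 fun Y => by rw [← hT, hk.apply_eq_smul]; simp
    rw [h, LieSubmodule.mem_bot] at this
    exact hk.2 this
  have hmain : ∀ X Y, τ X Y = c * killingForm ℂ g X Y := fun X =>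
    (hI X).1 (by rw [hIt]; exact LieSubmodule.mem_top X)
  refine ⟨c, ?_, hmain⟩
  -- A vanishing trace form makes the derived algebra, here `g` itself, act nilpotently.
  -- Faithfulness then makes `ad X₁` nilpotent, contradicting the nonzero Killing norm of `X₁`.
  rintro rfl
  have hτ0 : τ = 0 := LinearMap.ext fun X => LinearMap.ext fun Y => by rw [hmain]; simp
  have hnil := LieModule.isNilpotent_derivedSeries_of_traceForm_eq_zero hτ0
  rw [LieModule.isNilpotent_iff_forall' (R := ℂ)] at hnil
  have hX : X₁ ∈ LieAlgebra.derivedSeries ℂ g 1 := by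
    rw [derivedSeries_one_eq_top_of_isSimple]
    exact LieSubmodule.mem_top X₁
  have h1 : IsNilpotent (f X₁) := hnil ⟨X₁, hX⟩
  have hfinj : Function.Injective f := (lieEquivMatrix' (R := ℂ) (n := Fin d)).symm.injective.comp hρ
  have h2 := isNilpotent_ad_of_isNilpotent_map f hfinj h1
  refine hX₁ ?_
  rw [killingForm_apply_apply]
  exact (LinearMap.isNilpotent_trace_of_isNilpotent
    (Commute.isNilpotent_mul_right (Commute.refl _) h2)).eq_zero

end TraceForm

/-! ### Schur's lemma and twisted intertwiners -/

section Intertwiners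

variable {g : Type*} [LieRing g] [LieAlgebra ℂ g] {d : ℕ}

lemma mulVecLin_eq_zero_iff (M : Matrix (Fin d) (Fin d) ℂ) : M.mulVecLin = 0 ↔ M = 0 := by
  rw [← Matrix.toLin'_apply', LinearEquiv.map_eq_zero_iff]

/-- A matrix commuting with an irreducible representation is scalar: a traceless one vanishes. -/
lemma eq_zero_of_commute_of_trace_eq_zero {ρ : g →ₗ⁅ℂ⁆ Matrix (Fin d) (Fin d) ℂ}
    (hirr : IsIrreducibleRep ρ) {N : Matrix (Fin d) (Fin d) ℂ} (h : ∀ X, ρ X * N = N * ρ X)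
    (ht : N.trace = 0) : N = 0 := by
  have : Nonempty (Fin d) := ⟨⟨0, hirr.1⟩⟩
  obtain ⟨c, hc⟩ := Module.End.exists_eigenvalue N.mulVecLin
  obtain ⟨k, hk⟩ := hc.exists_hasEigenvector
  have htop : LinearMap.ker (N - c • (1 : Matrix (Fin d) (Fin d) ℂ)).mulVecLin = ⊤ := by
    refine (hirr.2 _ fun X w hw => ?_).resolve_left fun hbot => ?_
    · simp only [LinearMap.mem_ker, Matrix.mulVecLin_apply] at hw ⊢
      rw [Matrix.mulVec_mulVec, sub_mul, ← h X, Matrix.smul_mul, Matrix.one_mul,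
        show ρ X * N - c • ρ X = ρ X * (N - c • 1) by simp [mul_sub], ← Matrix.mulVec_mulVec, hw,
        Matrix.mulVec_zero]
    · have hmem : k ∈ LinearMap.ker (N - c • (1 : Matrix (Fin d) (Fin d) ℂ)).mulVecLin := by
        have := hk.apply_eq_smul
        rw [Matrix.mulVecLin_apply] at this
        simp [this]
      rw [hbot] at hmem
      exact hk.2 hmem
  have hN : N = c • (1 : Matrix (Fin d) (Fin d) ℂ) := by
    rw [← sub_eq_zero, ← mulVecLin_eq_zero_iff]
    exact LinearMap.ker_eq_top.1 htop
  rw [hN, Matrix.trace_smul, Matrix.trace_one, Fintype.card_fin, smul_eq_mul, mul_eq_zero] at ht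
  rcases ht with h0 | h0
  · rw [hN, h0, zero_smul]
  · exact absurd h0 (by exact_mod_cast hirr.1.ne')

/-- Triangular decompositions: a subspace which is stable under the lowering part and contains
a nonzero subspace stable under the Levi part and killed by the raising part is everything. -/
lemma eq_top_of_triangular {ρ : g →ₗ⁅ℂ⁆ Matrix (Fin d) (Fin d) ℂ} (hirr : IsIrreducibleRep ρ)
    {h p n : Set g} (hdec : ∀ X, ∃ y ∈ h, ∃ a ∈ p, ∃ c ∈ n, X = y + a + c)
    (hhn : ∀ y ∈ h, ∀ c ∈ n, ⁅y, c⁆ ∈ n) (hpn : ∀ a ∈ p, ∀ c ∈ n, ⁅a, c⁆ ∈ h)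
    {W P : Submodule ℂ (Fin d → ℂ)} (hWh : ∀ y ∈ h, ∀ w ∈ W, ρ y *ᵥ w ∈ W)
    (hWp : ∀ a ∈ p, ∀ w ∈ W, ρ a *ᵥ w = 0) (hWP : W ≤ P)
    (hP : ∀ c ∈ n, ∀ w ∈ P, ρ c *ᵥ w ∈ P) (hW : W ≠ ⊥) : P = ⊤ := by
  let 𝒮 : Set (Submodule ℂ (Fin d → ℂ)) := {Q | W ≤ Q ∧ ∀ c ∈ n, ∀ w ∈ Q, ρ c *ᵥ w ∈ Q}
  -- `U` is the span of `W` under words in the lowering part. Moving the other operators to the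
  -- right through such words shows that it is a subrepresentation, hence everything.
  let U := sInf 𝒮
  have hU : U ∈ 𝒮 := by
    refine ⟨le_sInf fun Q hQ => hQ.1, fun c hc w hw => ?_⟩
    rw [Submodule.mem_sInf] at hw ⊢
    exact fun Q hQ => hQ.2 c hc w (hw Q hQ)
  have hmul : ∀ x y : g, ∀ w, ρ x *ᵥ (ρ y *ᵥ w) = ρ y *ᵥ (ρ x *ᵥ w) + ρ ⁅x, y⁆ *ᵥ w := by
    intro x y w
    rw [LieHom.map_lie, LieRing.of_associative_ring_bracket, Matrix.sub_mulVec,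
      Matrix.mulVec_mulVec, Matrix.mulVec_mulVec]
    abel
  have hUh : ∀ y ∈ h, ∀ w ∈ U, ρ y *ᵥ w ∈ U := by
    -- Minimality of `U` replaces induction on words: the vectors of `U` kept in `U` by the Levi
    -- part form a member of `𝒮`.
    let Q : Submodule ℂ (Fin d → ℂ) :=
      { carrier := {w | w ∈ U ∧ ∀ y ∈ h, ρ y *ᵥ w ∈ U}
        zero_mem' := ⟨U.zero_mem, fun y _ => by rw [Matrix.mulVec_zero]; exact U.zero_mem⟩
        add_mem' := fun ha hb => ⟨U.add_mem ha.1 hb.1, fun y hy => by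
          rw [Matrix.mulVec_add]; exact U.add_mem (ha.2 y hy) (hb.2 y hy)⟩
        smul_mem' := fun t a ha => ⟨U.smul_mem t ha.1, fun y hy => by
          rw [Matrix.mulVec_smul]; exact U.smul_mem t (ha.2 y hy)⟩ }
    have hQ : U ≤ Q := by
      refine sInf_le ⟨fun w hw => ⟨hU.1 hw, fun y hy => hU.1 (hWh y hy w hw)⟩, ?_⟩
      rintro c hc w ⟨hw, hw'⟩
      refine ⟨hU.2 c hc w hw, fun y hy => ?_⟩
      rw [hmul]
      exact U.add_mem (hU.2 c hc _ (hw' y hy)) (hU.2 _ (hhn y hy c hc) w hw)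
    exact fun y hy w hw => (hQ hw).2 y hy
  have hUp : ∀ a ∈ p, ∀ w ∈ U, ρ a *ᵥ w ∈ U := by
    let Q : Submodule ℂ (Fin d → ℂ) :=
      { carrier := {w | w ∈ U ∧ ∀ y ∈ p, ρ y *ᵥ w ∈ U}
        zero_mem' := ⟨U.zero_mem, fun y _ => by rw [Matrix.mulVec_zero]; exact U.zero_mem⟩
        add_mem' := fun ha hb => ⟨U.add_mem ha.1 hb.1, fun y hy => by
          rw [Matrix.mulVec_add]; exact U.add_mem (ha.2 y hy) (hb.2 y hy)⟩
        smul_mem' := fun t a ha => ⟨U.smul_mem t ha.1, fun y hy => by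
          rw [Matrix.mulVec_smul]; exact U.smul_mem t (ha.2 y hy)⟩ }
    have hQ : U ≤ Q := by
      refine sInf_le ⟨fun w hw => ⟨hU.1 hw, fun a ha => ?_⟩, ?_⟩
      · rw [hWp a ha w hw]; exact U.zero_mem
      rintro c hc w ⟨hw, hw'⟩
      refine ⟨hU.2 c hc w hw, fun a ha => ?_⟩
      rw [hmul]
      exact U.add_mem (hU.2 c hc _ (hw' a ha)) (hUh _ (hpn a ha c hc) w hw)
    exact fun y hy w hw => (hQ hw).2 y hy
  have hUP : U ≤ P := sInf_le ⟨hWP, hP⟩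
  rcases hirr.2 U fun X w hw => by
    obtain ⟨y, hy, a, ha, c, hc, rfl⟩ := hdec X
    rw [map_add, map_add, Matrix.add_mulVec, Matrix.add_mulVec]
    exact U.add_mem (U.add_mem (hUh y hy w hw) (hUp a ha w hw)) (hU.2 c hc w hw) with h0 | h0
  · exact absurd (le_bot_iff.1 (h0 ▸ hU.1)) hW
  · exact top_le_iff.1 (h0 ▸ hUP)

/-- An eigenvector of `A⁻¹ A'` on `W`, where `A` is invertible. It yields a combination `A' - c A`
with a kernel in `W`. -/
lemma exists_relative_eigenvector {V : Type*} [AddCommGroup V] [Module ℂ V] [Module.Finite ℂ V]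
    (A A' : V →ₗ[ℂ] V) {W : Submodule ℂ V} (hW : W ≠ ⊥) (hA : ∀ w ∈ W, A w ∈ W)
    (hA' : ∀ w ∈ W, A' w ∈ W) (hinj : ∀ w ∈ W, A w = 0 → w = 0) :
    ∃ c : ℂ, ∃ w ∈ W, w ≠ 0 ∧ A' w = c • A w := by
  have : Nontrivial W := Submodule.nontrivial_iff_ne_bot.2 hW
  have hAi : Function.Injective (A.restrict hA) := by
    rw [← LinearMap.ker_eq_bot, LinearMap.ker_eq_bot']
    exact fun w hw => Subtype.ext (hinj w w.2 (congrArg Subtype.val hw))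
  let e := LinearEquiv.ofInjectiveEndo _ hAi
  obtain ⟨c, hc⟩ := Module.End.exists_eigenvalue ((e.symm : W →ₗ[ℂ] W) ∘ₗ A'.restrict hA')
  obtain ⟨w, hw⟩ := hc.exists_hasEigenvector
  refine ⟨c, w, w.2, fun h0 => hw.2 (Subtype.ext h0), ?_⟩
  have h1 := congrArg e hw.apply_eq_smul
  simp only [LinearMap.comp_apply, LinearEquiv.coe_coe, LinearEquiv.apply_symm_apply,
    map_smul] at h1
  exact congrArg Subtype.val h1

/-- The linear equations for the values of a solution of the classical boundary Yang-Baxter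
equation, obtained by sending one of the spectral parameters to infinity. -/
structure IsTwistedIntertwiner (ρ : g →ₗ⁅ℂ⁆ Matrix (Fin d) (Fin d) ℂ) (α : g ≃ₗ⁅ℂ⁆ g) (Z : g)
    (t : ℂ) (C : Matrix (Fin d) (Fin d) ℂ) : Prop where
  commute : ∀ y, α y = y → ρ y * C = C * ρ y
  twisted : ∀ a, α a = -a → ρ (t • a + ⁅Z, a⁆) * C = C * ρ (t • a - ⁅Z, a⁆)

variable {ρ : g →ₗ⁅ℂ⁆ Matrix (Fin d) (Fin d) ℂ} {α : g ≃ₗ⁅ℂ⁆ g} {Z : g} {t : ℂ}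
  {A A' C : Matrix (Fin d) (Fin d) ℂ}

lemma IsTwistedIntertwiner.sub_smul (h' : IsTwistedIntertwiner ρ α Z t A')
    (h : IsTwistedIntertwiner ρ α Z t A) (c : ℂ) :
    IsTwistedIntertwiner ρ α Z t (A' - c • A) where
  commute y hy := by
    rw [mul_sub, sub_mul, h'.commute y hy, Matrix.mul_smul, Matrix.smul_mul, h.commute y hy]
  twisted a ha := by
    rw [mul_sub, sub_mul, h'.twisted a ha, Matrix.mul_smul, Matrix.smul_mul, h.twisted a ha]

/-- On the odd part `(t - ad Z)(t + ad Z) = t² - l` is invertible, so every `C ρ(a)` with `a` odd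
can be rewritten as `ρ(a'') C`. Hence the kernel of `C` is a subrepresentation. -/
lemma IsTwistedIntertwiner.eq_zero_of_regular (hirr : IsIrreducibleRep ρ)
    (hα : ∀ X, α (α X) = X) (hZ : α Z = Z) {l : ℂ} (hl : ∀ a, α a = -a → ⁅Z, ⁅Z, a⁆⁆ = l • a)
    (ht : t ^ 2 ≠ l) (h : IsTwistedIntertwiner ρ α Z t C) {w : Fin d → ℂ} (hw0 : w ≠ 0)
    (hw : C *ᵥ w = 0) : C = 0 := by
  have ht' : t ^ 2 - l ≠ 0 := sub_ne_zero.2 ht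
  rw [← mulVecLin_eq_zero_iff, ← LinearMap.ker_eq_top]
  refine (hirr.2 _ fun X x hx => ?_).resolve_left fun hbot => ?_
  · obtain ⟨y, a, hy, ha, rfl⟩ := exists_fixed_add_anti α hα X
    have hx' : C *ᵥ x = 0 := hx
    -- The solution of `t • a' - ⁅Z, a'⁆ = a`.
    let a' := (t ^ 2 - l)⁻¹ • (t • a + ⁅Z, a⁆)
    have ha' : α a' = -a' := by
      simp only [a', map_smul, map_add, LieEquiv.map_lie, hZ, ha, lie_neg, smul_neg, ← neg_add]
    have haa : t • a' - ⁅Z, a'⁆ = a := by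
      simp only [a', lie_smul, lie_add, hl a ha]
      rw [smul_comm t, ← smul_sub, inv_smul_eq_iff₀ ht']
      module
    have h1 := h.twisted a' ha'
    rw [haa] at h1
    simp only [LinearMap.mem_ker, Matrix.mulVecLin_apply]
    rw [Matrix.mulVec_mulVec, map_add, mul_add, ← h.commute y hy, ← h1, ← add_mul,
      ← Matrix.mulVec_mulVec, hx', Matrix.mulVec_zero]
  · have : w ∈ LinearMap.ker C.mulVecLin := hw
    rw [hbot] at this
    exact hw0 this

lemma IsTwistedIntertwiner.raising_mul (ht : t ≠ 0) (h : IsTwistedIntertwiner ρ α Z t C) {a : g}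
    (ha : α a = -a) (hZa : ⁅Z, a⁆ = t • a) : ρ a * C = 0 := by
  have h1 := h.twisted a ha
  rw [hZa, sub_self, map_zero, mul_zero, ← two_smul ℂ, map_smul, map_smul, Matrix.smul_mul,
    Matrix.smul_mul] at h1
  simpa [ht] using h1

lemma IsTwistedIntertwiner.mul_lowering (ht : t ≠ 0) (h : IsTwistedIntertwiner ρ α Z t C) {a : g}
    (ha : α a = -a) (hZa : ⁅Z, a⁆ = -(t • a)) : C * ρ a = 0 := by
  have h1 := h.twisted a ha
  rw [hZa, add_neg_cancel, map_zero, zero_mul, sub_neg_eq_add, ← two_smul ℂ, map_smul, map_smul,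
    Matrix.mul_smul, Matrix.mul_smul] at h1
  simpa [ht] using h1.symm

/-- Here `ad Z` has only the eigenvalues `±t` on the odd part. Vectors of `ker C` killed by the
`t`-eigenspace form a space stable under the fixed part, while `ker C` is stable under the
`-t`-eigenspace because `C` annihilates its image. The triangular decomposition then forces `ker C`
to be everything. -/
lemma IsTwistedIntertwiner.eq_zero_of_singular (hirr : IsIrreducibleRep ρ)
    (hα : ∀ X, α (α X) = X) (hZ : α Z = Z) (hc : ∀ y, α y = y → ⁅Z, y⁆ = 0) (ht0 : t ≠ 0)
    (hl : ∀ a, α a = -a → ⁅Z, ⁅Z, a⁆⁆ = t ^ 2 • a)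
    (h : IsTwistedIntertwiner ρ α Z t C) {w : Fin d → ℂ} (hw0 : w ≠ 0)
    (hwp : ∀ a, α a = -a → ⁅Z, a⁆ = t • a → ρ a *ᵥ w = 0)
    (hw : C *ᵥ w = 0) : C = 0 := by
  have hcomm : ∀ y a : g, α y = y → ⁅Z, ⁅y, a⁆⁆ = ⁅y, ⁅Z, a⁆⁆ := by
    intro y a hy
    rw [leibniz_lie, hc y hy, zero_lie, zero_add]
  have hanti : ∀ y a, α y = y → α a = -a → α ⁅y, a⁆ = -⁅y, a⁆ := by
    intro y a hy ha
    rw [LieEquiv.map_lie, hy, ha, lie_neg]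
  let W : Submodule ℂ (Fin d → ℂ) :=
    { carrier := {w | C *ᵥ w = 0 ∧ ∀ a, α a = -a → ⁅Z, a⁆ = t • a → ρ a *ᵥ w = 0}
      zero_mem' := ⟨Matrix.mulVec_zero _, fun _ _ _ => Matrix.mulVec_zero _⟩
      add_mem' := fun hx hy => ⟨by rw [Matrix.mulVec_add, hx.1, hy.1, add_zero],
        fun a ha hZa => by rw [Matrix.mulVec_add, hx.2 a ha hZa, hy.2 a ha hZa, add_zero]⟩
      smul_mem' := fun s x hx => ⟨by rw [Matrix.mulVec_smul, hx.1, smul_zero],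
        fun a ha hZa => by rw [Matrix.mulVec_smul, hx.2 a ha hZa, smul_zero]⟩ }
  rw [← mulVecLin_eq_zero_iff, ← LinearMap.ker_eq_top]
  refine eq_top_of_triangular (W := W) hirr (h := {y | α y = y})
    (p := {a | α a = -a ∧ ⁅Z, a⁆ = t • a}) (n := {a | α a = -a ∧ ⁅Z, a⁆ = -(t • a)})
    ?_ ?_ ?_ ?_ ?_ ?_ ?_ ?_
  · intro X
    obtain ⟨y, a, hy, ha, rfl⟩ := exists_fixed_add_anti α hα X
    -- The two spectral projections of `ad Z` on the odd part.
    refine ⟨y, hy, (2 * t)⁻¹ • (t • a + ⁅Z, a⁆), ⟨?_, ?_⟩, (2 * t)⁻¹ • (t • a - ⁅Z, a⁆),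
      ⟨?_, ?_⟩, ?_⟩
    · rw [map_smul, map_add, map_smul, hanti _ _ hZ ha, ha]; module
    · rw [lie_smul, lie_add, lie_smul, hl a ha]; module
    · rw [map_smul, map_sub, map_smul, hanti _ _ hZ ha, ha]; module
    · rw [lie_smul, lie_sub, lie_smul, hl a ha]; module
    · rw [add_assoc, ← smul_add, show t • a + ⁅Z, a⁆ + (t • a - ⁅Z, a⁆) = (2 * t) • a by module,
        inv_smul_smul₀ (mul_ne_zero two_ne_zero ht0)]
  · rintro y hy c ⟨hc1, hc2⟩
    refine ⟨hanti y c hy hc1, ?_⟩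
    rw [hcomm y c hy, hc2, lie_neg, lie_smul]
  · rintro a ⟨ha, -⟩ c ⟨hc', -⟩
    change α ⁅a, c⁆ = ⁅a, c⁆
    rw [LieEquiv.map_lie, ha, hc', neg_lie, lie_neg, neg_neg]
  · rintro y hy x ⟨hx1, hx2⟩
    refine ⟨?_, fun a ha hZa => ?_⟩
    · rw [Matrix.mulVec_mulVec, ← h.commute y hy, ← Matrix.mulVec_mulVec, hx1, Matrix.mulVec_zero]
    · have h1 := hx2 ⁅a, y⁆ (by rw [← lie_skew, map_neg, hanti y a hy ha])
        (by rw [← lie_skew a y, lie_neg, hcomm y a hy, hZa, lie_smul, smul_neg])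
      rw [LieHom.map_lie, LieRing.of_associative_ring_bracket, Matrix.sub_mulVec,
        ← Matrix.mulVec_mulVec, ← Matrix.mulVec_mulVec, hx2 a ha hZa, Matrix.mulVec_zero,
        sub_zero] at h1
      exact h1
  · rintro a ⟨ha, hZa⟩ x hx
    exact hx.2 a ha hZa
  · exact fun x hx => hx.1
  · rintro c ⟨hc1, hc2⟩ x -
    simp only [LinearMap.mem_ker, Matrix.mulVecLin_apply]
    rw [Matrix.mulVec_mulVec, h.mul_lowering ht0 hc1 hc2, Matrix.zero_mulVec]
  · intro hbot
    have : w ∈ W := ⟨hw, hwp⟩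
    rw [hbot] at this
    exact hw0 this

/-- Twisted intertwiners are determined by their trace, if it does not vanish. -/
lemma IsTwistedIntertwiner.unique [LieAlgebra.IsSimple ℂ g] [Module.Finite ℂ g]
    (hirr : IsIrreducibleRep ρ) (hα : ∀ X, α (α X) = X) (hZ : α Z = Z)
    (hc : ∀ y, α y = y → ⁅Z, y⁆ = 0) (ht0 : t ≠ 0) (h : IsTwistedIntertwiner ρ α Z t A)
    (h' : IsTwistedIntertwiner ρ α Z t A') (htr : A.trace ≠ 0) (htr' : A'.trace = A.trace) :
    A' = A := by
  obtain ⟨l, hl⟩ := exists_lie_lie_eq_smul hα hZ hc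
  have hA : A ≠ 0 := by rintro rfl; simp at htr
  -- A space containing both images, on which every nonzero twisted intertwiner is injective: the
  -- whole space in the regular case, the vectors killed by the raising part in the singular one.
  have key : ∃ W : Submodule ℂ (Fin d → ℂ), (∀ x, A *ᵥ x ∈ W) ∧ (∀ x, A' *ᵥ x ∈ W) ∧
      ∀ C, IsTwistedIntertwiner ρ α Z t C → ∀ w ∈ W, w ≠ 0 → C *ᵥ w = 0 → C = 0 := by
    by_cases ht : t ^ 2 = l
    · subst ht
      let W : Submodule ℂ (Fin d → ℂ) :=
        { carrier := {w | ∀ a, α a = -a → ⁅Z, a⁆ = t • a → ρ a *ᵥ w = 0}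
          zero_mem' := fun _ _ _ => Matrix.mulVec_zero _
          add_mem' := fun hx hy a ha hZa => by
            rw [Matrix.mulVec_add, hx a ha hZa, hy a ha hZa, add_zero]
          smul_mem' := fun s x hx a ha hZa => by
            rw [Matrix.mulVec_smul, hx a ha hZa, smul_zero] }
      refine ⟨W, fun x a ha hZa => ?_, fun x a ha hZa => ?_, fun C hC w hw hw0 hCw => ?_⟩
      · rw [Matrix.mulVec_mulVec, h.raising_mul ht0 ha hZa, Matrix.zero_mulVec]
      · rw [Matrix.mulVec_mulVec, h'.raising_mul ht0 ha hZa, Matrix.zero_mulVec]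
      · exact hC.eq_zero_of_singular hirr hα hZ hc ht0 hl hw0 hw hCw
    · exact ⟨⊤, fun _ => Submodule.mem_top, fun _ => Submodule.mem_top,
        fun C hC w _ hw0 hCw => hC.eq_zero_of_regular hirr hα hZ hl ht hw0 hCw⟩
  obtain ⟨W, hW, hW', hker⟩ := key
  have hWbot : W ≠ ⊥ := by
    rintro rfl
    refine hA ((mulVecLin_eq_zero_iff _).1 (LinearMap.ext fun x => ?_))
    exact (Submodule.mem_bot ℂ).1 (hW x)
  obtain ⟨c, w, hw, hw0, hcw⟩ := exists_relative_eigenvector A.mulVecLin A'.mulVecLin hWbot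
    (fun x _ => hW x) (fun x _ => hW' x)
    fun x hx hAx => by_contra fun hx0 => hA (hker A h x hx hx0 hAx)
  have h0 : A' - c • A = 0 := hker _ (h'.sub_smul h c) w hw hw0 (by
    simp only [Matrix.mulVecLin_apply] at hcw
    rw [Matrix.sub_mulVec, Matrix.smul_mulVec, hcw, sub_self])
  have h1 : A' = c • A := sub_eq_zero.1 h0
  have h2 : c = 1 := by
    rw [h1, Matrix.trace_smul, smul_eq_mul] at htr'
    exact (mul_eq_right₀ htr).1 htr'
  rw [h1, h2, one_smul]

end Intertwiners

open Filter Topology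

/-! ### Limits and error terms at infinity -/

section Asymptotics

variable {d : ℕ}

lemma EqUpToOrder.map {n : ℕ} {M N : ℂ → Matrix (Fin d) (Fin d) ℂ} (h : EqUpToOrder n M N)
    (f : Matrix (Fin d) (Fin d) ℂ →ₗ[ℂ] Matrix (Fin d) (Fin d) ℂ) :
    EqUpToOrder n (fun u => f (M u)) (fun u => f (N u)) := by
  intro i j
  have hf : ∀ u, f (M u) i j - f (N u) i j =
      ∑ k, ∑ l, f (Matrix.single k l 1) i j * (M u k l - N u k l) := by
    intro u
    rw [← Matrix.sub_apply, ← map_sub, Matrix.matrix_eq_sum_single (M u - N u)]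
    simp only [map_sum, Matrix.sum_apply]
    refine Finset.sum_congr rfl fun k _ => Finset.sum_congr rfl fun l _ => ?_
    rw [show Matrix.single k l ((M u - N u) k l) =
      ((M u - N u) k l) • Matrix.single k l (1 : ℂ) by simp [Matrix.smul_single], map_smul,
      Matrix.smul_apply, smul_eq_mul, mul_comm, Matrix.sub_apply]
  simp only [hf]
  exact Asymptotics.IsBigO.fun_sum fun k _ => Asymptotics.IsBigO.fun_sum fun l _ =>
    (h k l).const_mul_left _

lemma EqUpToOrder.tendsto {M : ℂ → Matrix (Fin d) (Fin d) ℂ} {L : Matrix (Fin d) (Fin d) ℂ}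
    (h : EqUpToOrder 1 M fun _ => L) : Tendsto M (Bornology.cobounded ℂ) (𝓝 L) := by
  refine tendsto_pi_nhds.2 fun i => tendsto_pi_nhds.2 fun j => ?_
  have h0 : Tendsto (fun u : ℂ => (u ^ 1)⁻¹) (Bornology.cobounded ℂ) (𝓝 0) := by
    simpa using tendsto_inv₀_cobounded (α := ℂ)
  simpa using ((h i j).trans_tendsto h0).add_const (L i j)

lemma continuous_leg₁ : Continuous (leg₁ : Matrix (Fin d) (Fin d) ℂ → _) := by
  refine continuous_pi fun i => continuous_pi fun j => ?_
  simp only [leg₁, Matrix.kroneckerMap_apply]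
  fun_prop

lemma continuous_leg₂ : Continuous (leg₂ : Matrix (Fin d) (Fin d) ℂ → _) := by
  refine continuous_pi fun i => continuous_pi fun j => ?_
  simp only [leg₂, Matrix.kroneckerMap_apply]
  fun_prop

lemma tendsto_div_sub_cobounded (v : ℂ) :
    Tendsto (fun u : ℂ => u / (u - v)) (Bornology.cobounded ℂ) (𝓝 1) := by
  have h0 : Tendsto (fun u : ℂ => u⁻¹) (Bornology.cobounded ℂ) (𝓝 0) := tendsto_inv₀_cobounded
  have h1 : Tendsto (fun u : ℂ => (1 - v * u⁻¹)⁻¹) (Bornology.cobounded ℂ) (𝓝 1) := by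
    simpa using ((h0.const_mul v).const_sub 1).inv₀ (by simp)
  refine h1.congr' ?_
  filter_upwards [Bornology.isBounded_def.1 (Bornology.isBounded_singleton (x := (0 : ℂ)))] with u hu
  have hu0 : u ≠ 0 := hu
  rw [show u - v = u * (1 - v * u⁻¹) by field_simp, ← div_div, div_self hu0, one_div]

variable {g : Type*} [LieRing g] [LieAlgebra ℂ g] {ι : Type*} [Fintype ι] [DecidableEq ι]
  (b : Module.Basis ι ℂ g)

lemma tendsto_casimirPairing {l : Filter ℂ} {F G : ℂ → g →ₗ[ℂ] Matrix (Fin d) (Fin d) ℂ}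
    {F₀ G₀ : g →ₗ[ℂ] Matrix (Fin d) (Fin d) ℂ}
    (hF : ∀ X, Tendsto (fun u => F u X) l (𝓝 (F₀ X)))
    (hG : ∀ X, Tendsto (fun u => G u X) l (𝓝 (G₀ X))) :
    Tendsto (fun u => casimirPairing b (F u) (G u)) l (𝓝 (casimirPairing b F₀ G₀)) := by
  refine tendsto_finsetSum _ fun A _ => tendsto_finsetSum _ fun B _ => Tendsto.const_smul ?_ _
  refine tendsto_pi_nhds.2 fun i => tendsto_pi_nhds.2 fun j => ?_
  simp only [Matrix.kroneckerMap_apply]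
  exact (tendsto_pi_nhds.1 (tendsto_pi_nhds.1 (hF (b A)) i.1) j.1).mul
    (tendsto_pi_nhds.1 (tendsto_pi_nhds.1 (hG (b B)) i.2) j.2)

end Asymptotics

/-! ### The boundary equation normalized and taken to infinity -/

section BoundaryEquation

variable {g : Type*} [LieRing g] [LieAlgebra ℂ g] {ι : Type*} [Fintype ι] [DecidableEq ι]
  {b : Module.Basis ι ℂ g} {d : ℕ} {ρ₁ ρ₂ : g →ₗ⁅ℂ⁆ Matrix (Fin d) (Fin d) ℂ}
  {κ : Matrix (Fin d) (Fin d) ℂ} {D : Set ℂ} {κt : ℂ → Matrix (Fin d) (Fin d) ℂ}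

lemma leg₁_mul (M N : Matrix (Fin d) (Fin d) ℂ) : leg₁ (M * N) = leg₁ M * leg₁ N := by
  simp [leg₁, ← Matrix.mul_kronecker_mul]

lemma leg₂_mul (M N : Matrix (Fin d) (Fin d) ℂ) : leg₂ (M * N) = leg₂ M * leg₂ N := by
  simp [leg₂, ← Matrix.mul_kronecker_mul]

lemma leg₁_mul_leg₂ (M N : Matrix (Fin d) (Fin d) ℂ) : leg₁ M * leg₂ N = leg₂ N * leg₁ M := by
  simp [leg₁, leg₂, ← Matrix.mul_kronecker_mul]

lemma leg₁_one : leg₁ (1 : Matrix (Fin d) (Fin d) ℂ) = 1 := by simp [leg₁]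

lemma leg₂_one : leg₂ (1 : Matrix (Fin d) (Fin d) ℂ) = 1 := by simp [leg₂]

/-- A representation conjugated by an invertible matrix, as a linear map. -/
noncomputable def conjMap (κ : Matrix (Fin d) (Fin d) ℂ) (ρ : g →ₗ⁅ℂ⁆ Matrix (Fin d) (Fin d) ℂ) :
    g →ₗ[ℂ] Matrix (Fin d) (Fin d) ℂ :=
  LinearMap.mulRight ℂ κ⁻¹ ∘ₗ LinearMap.mulLeft ℂ κ ∘ₗ (ρ : g →ₗ[ℂ] Matrix (Fin d) (Fin d) ℂ)

lemma conjMap_apply (X : g) : conjMap κ ρ₂ X = κ * ρ₂ X * κ⁻¹ := rfl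

/-- The boundary Yang-Baxter equation for `κt(u) κ⁻¹`. -/
lemma IsKappaSolution.normalized_eq (h : IsKappaSolution b ρ₁ ρ₂ κ D κt) (hκ : IsUnit κ)
    {u v : ℂ} (hu : u ∈ D) (hv : v ∈ D) (h1 : u ≠ v) (h2 : u ≠ -v) :
    (1 / (u - v)) • (casimirPairing b ρ₁ ρ₁ * leg₁ (κt u * κ⁻¹) * leg₂ (κt v * κ⁻¹)
        - leg₁ (κt u * κ⁻¹) * leg₂ (κt v * κ⁻¹) * casimirPairing b (conjMap κ ρ₂) (conjMap κ ρ₂))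
      + (1 / (u + v)) •
        (leg₁ (κt u * κ⁻¹) * casimirPairing b (conjMap κ ρ₂) ρ₁ * leg₂ (κt v * κ⁻¹)
        - leg₂ (κt v * κ⁻¹) * casimirPairing b ρ₁ (conjMap κ ρ₂) * leg₁ (κt u * κ⁻¹)) = 0 := by
  have h0 := congrArg (fun W => W * (leg₁ κ⁻¹ * leg₂ κ⁻¹)) (h.classicalBYBE u hu v hv h1 h2)
  simp only [casimirTensor_eq_casimirPairing, zero_mul, add_mul, smul_mul_assoc, sub_mul] at h0
  have hdet : IsUnit κ.det := (Matrix.isUnit_iff_isUnit_det κ).1 hκ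
  -- The relation `κ⁻¹ σ = ρ₂ κ⁻¹` carries the factors `κ⁻¹` leftwards through the Casimir tensors.
  have hσ : LinearMap.mulLeft ℂ κ⁻¹ ∘ₗ conjMap κ ρ₂ =
      LinearMap.mulRight ℂ κ⁻¹ ∘ₗ (ρ₂ : g →ₗ[ℂ] Matrix (Fin d) (Fin d) ℂ) := by
    ext1 X
    simp only [LinearMap.comp_apply, LinearMap.mulLeft_apply, LinearMap.mulRight_apply,
      conjMap_apply]
    rw [← mul_assoc, ← mul_assoc, Matrix.nonsing_inv_mul _ hdet, one_mul]
    rfl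
  have e1 : ∀ G : g →ₗ[ℂ] Matrix (Fin d) (Fin d) ℂ,
      casimirPairing b ρ₂ G * leg₁ κ⁻¹ = leg₁ κ⁻¹ * casimirPairing b (conjMap κ ρ₂) G := by
    intro G
    rw [casimirPairing_mul_leg₁, leg₁_mul_casimirPairing, hσ]
  have e2 : ∀ F : g →ₗ[ℂ] Matrix (Fin d) (Fin d) ℂ,
      casimirPairing b F ρ₂ * leg₂ κ⁻¹ = leg₂ κ⁻¹ * casimirPairing b F (conjMap κ ρ₂) := by
    intro F
    rw [casimirPairing_mul_leg₂, leg₂_mul_casimirPairing, hσ]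
  have t1 : casimirPairing b ρ₁ ρ₁ * leg₁ (κt u) * leg₂ (κt v) * (leg₁ κ⁻¹ * leg₂ κ⁻¹) =
      casimirPairing b ρ₁ ρ₁ * leg₁ (κt u * κ⁻¹) * leg₂ (κt v * κ⁻¹) := by
    simp only [leg₁_mul, leg₂_mul, mul_assoc]
    rw [← mul_assoc (leg₂ (κt v)), ← leg₁_mul_leg₂, mul_assoc]
  have t2 : leg₁ (κt u) * leg₂ (κt v) * casimirPairing b ρ₂ ρ₂ * (leg₁ κ⁻¹ * leg₂ κ⁻¹) =
      leg₁ (κt u * κ⁻¹) * leg₂ (κt v * κ⁻¹) *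
        casimirPairing b (conjMap κ ρ₂) (conjMap κ ρ₂) := by
    rw [← mul_assoc, mul_assoc _ _ (leg₁ κ⁻¹), e1]
    simp only [leg₁_mul, leg₂_mul, mul_assoc]
    rw [e2, ← mul_assoc (leg₂ (κt v)), ← leg₁_mul_leg₂, mul_assoc]
  have t3 : leg₁ (κt u) * casimirPairing b ρ₂ ρ₁ * leg₂ (κt v) * (leg₁ κ⁻¹ * leg₂ κ⁻¹) =
      leg₁ (κt u * κ⁻¹) * casimirPairing b (conjMap κ ρ₂) ρ₁ * leg₂ (κt v * κ⁻¹) := by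
    simp only [leg₁_mul, leg₂_mul, mul_assoc]
    rw [← mul_assoc (leg₂ (κt v)), ← leg₁_mul_leg₂, mul_assoc,
      ← mul_assoc _ (leg₁ κ⁻¹), e1, mul_assoc]
  have t4 : leg₂ (κt v) * casimirPairing b ρ₁ ρ₂ * leg₁ (κt u) * (leg₁ κ⁻¹ * leg₂ κ⁻¹) =
      leg₂ (κt v * κ⁻¹) * casimirPairing b ρ₁ (conjMap κ ρ₂) * leg₁ (κt u * κ⁻¹) := by
    rw [leg₁_mul_leg₂]
    simp only [leg₁_mul, leg₂_mul, mul_assoc]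
    rw [← mul_assoc (leg₁ (κt u)), leg₁_mul_leg₂, mul_assoc,
      ← mul_assoc _ (leg₂ κ⁻¹), e2, mul_assoc]
  rwa [t1, t2, t3, t4] at h0

lemma IsKappaSolution.normalized_limit (h : IsKappaSolution b ρ₁ ρ₂ κ D κt) (hκ : IsUnit κ) :
    EqUpToOrder 1 (fun u => κt u * κ⁻¹) fun _ => 1 := by
  have h0 := h.limit.map (LinearMap.mulRight ℂ κ⁻¹)
  simpa [Matrix.mul_nonsing_inv _ ((Matrix.isUnit_iff_isUnit_det κ).1 hκ)] using h0

lemma eventually_mem_ne {D : Set ℂ} (hD : D ∈ Bornology.cobounded ℂ) (v : ℂ) :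
    ∀ᶠ u in Bornology.cobounded ℂ, u ∈ D ∧ u ≠ v ∧ u ≠ -v := by
  filter_upwards [hD, Bornology.isBounded_def.1 (Bornology.isBounded_singleton (x := v)),
    Bornology.isBounded_def.1 (Bornology.isBounded_singleton (x := -v))] with u h1 h2 h3
  exact ⟨h1, h2, h3⟩

/-- The boundary Yang-Baxter equation with the first spectral parameter at infinity. -/
lemma IsKappaSolution.eq_at_infinity (h : IsKappaSolution b ρ₁ ρ₂ κ D κt) (hκ : IsUnit κ)
    (hD : D ∈ Bornology.cobounded ℂ) {v : ℂ} (hv : v ∈ D) :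
    casimirPairing b ρ₁ ρ₁ * leg₂ (κt v * κ⁻¹)
        - leg₂ (κt v * κ⁻¹) * casimirPairing b (conjMap κ ρ₂) (conjMap κ ρ₂)
      + (casimirPairing b (conjMap κ ρ₂) ρ₁ * leg₂ (κt v * κ⁻¹)
        - leg₂ (κt v * κ⁻¹) * casimirPairing b ρ₁ (conjMap κ ρ₂)) = 0 := by
  have hA : Tendsto (fun u => leg₁ (κt u * κ⁻¹)) (Bornology.cobounded ℂ) (𝓝 1) := by
    rw [← leg₁_one]
    exact (continuous_leg₁.tendsto _).comp (h.normalized_limit hκ).tendsto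
  have h1 := tendsto_div_sub_cobounded v
  have h2 := tendsto_div_sub_cobounded (-v)
  simp only [sub_neg_eq_add] at h2
  have hlim := (h1.smul (((hA.const_mul (casimirPairing b ρ₁ ρ₁)).mul_const
      (leg₂ (κt v * κ⁻¹))).sub ((hA.mul_const (leg₂ (κt v * κ⁻¹))).mul_const
        (casimirPairing b (conjMap κ ρ₂) (conjMap κ ρ₂))))).add
    (h2.smul (((hA.mul_const (casimirPairing b (conjMap κ ρ₂) ρ₁)).mul_const
      (leg₂ (κt v * κ⁻¹))).sub (hA.const_mul
        (leg₂ (κt v * κ⁻¹) * casimirPairing b ρ₁ (conjMap κ ρ₂)))))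
  simp only [one_smul, mul_one, one_mul] at hlim
  refine tendsto_nhds_unique hlim (tendsto_const_nhds.congr' ?_)
  filter_upwards [eventually_mem_ne hD v] with u ⟨hu, hu1, hu2⟩
  -- After multiplication by `u` the scalar coefficients `u / (u ∓ v)` tend to `1`.
  have h0 := congrArg (fun W => u • W) (h.normalized_eq hκ hu hv hu1 hu2)
  simp only [smul_zero, smul_add, smul_smul, mul_one_div] at h0
  exact h0.symm

/-- The second parameter also goes to infinity, and the four remaining Casimir tensors factor. -/
lemma IsKappaSolution.casimirPairing_add_sub (h : IsKappaSolution b ρ₁ ρ₂ κ D κt)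
    (hκ : IsUnit κ) (hD : D ∈ Bornology.cobounded ℂ) :
    casimirPairing b ((ρ₁ : g →ₗ[ℂ] Matrix (Fin d) (Fin d) ℂ) + conjMap κ ρ₂)
      ((ρ₁ : g →ₗ[ℂ] Matrix (Fin d) (Fin d) ℂ) - conjMap κ ρ₂) = 0 := by
  have hA : Tendsto (fun u => leg₂ (κt u * κ⁻¹)) (Bornology.cobounded ℂ) (𝓝 1) := by
    rw [← leg₂_one]
    exact (continuous_leg₂.tendsto _).comp (h.normalized_limit hκ).tendsto
  have hlim := ((hA.const_mul (casimirPairing b ρ₁ ρ₁)).sub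
      (hA.mul_const (casimirPairing b (conjMap κ ρ₂) (conjMap κ ρ₂)))).add
    ((hA.const_mul (casimirPairing b (conjMap κ ρ₂) ρ₁)).sub
      (hA.mul_const (casimirPairing b ρ₁ (conjMap κ ρ₂))))
  have h0 := tendsto_nhds_unique hlim (tendsto_const_nhds.congr' (f₁ := fun _ => 0) (by
    filter_upwards [hD] with v hv using (h.eq_at_infinity hκ hD hv).symm))
  rw [casimirPairing_add_left, casimirPairing_sub_right, casimirPairing_sub_right, ← h0]
  simp only [one_mul, mul_one]
  abel

end BoundaryEquation

/-! ### The involution from the value at infinity -/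

section Involution

variable {g : Type*} [LieRing g] [LieAlgebra ℂ g] [LieAlgebra.IsKilling ℂ g]
  {ι : Type*} [Fintype ι] [DecidableEq ι] (b : Module.Basis ι ℂ g) {d : ℕ}

/-- A functional on `g` vanishing on `ker G` factors through `G`, so it is available for contraction
even when `G` is not injective. -/
lemma apply_eq_zero_of_casimirPairing_eq_zero {F G : g →ₗ[ℂ] Matrix (Fin d) (Fin d) ℂ}
    (h : casimirPairing b F G = 0) {X : g} (hX : ∀ Y, G Y = 0 → killingForm ℂ g X Y = 0) :
    F X = 0 := by
  have : Module.Finite ℂ g := Module.Finite.of_basis b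
  have hmem : killingForm ℂ g X ∈ LinearMap.range G.dualMap := by
    rw [LinearMap.range_dualMap_eq_dualAnnihilator_ker, Submodule.mem_dualAnnihilator]
    exact fun Y hY => hX Y hY
  obtain ⟨φ, hφ⟩ := hmem
  rw [← contractLeg₂_casimirPairing_of_eq b (F := F) (G := G) (φ := φ)
    fun Y => LinearMap.congr_fun hφ Y, h, map_zero]

lemma exists_involution (ρ : g →ₗ⁅ℂ⁆ Matrix (Fin d) (Fin d) ℂ) (hρ : Function.Injective ρ)
    (σ : g →ₗ[ℂ] Matrix (Fin d) (Fin d) ℂ) (hσ : ∀ X Y, σ ⁅X, Y⁆ = σ X * σ Y - σ Y * σ X)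
    (h : casimirPairing b ((ρ : g →ₗ[ℂ] Matrix (Fin d) (Fin d) ℂ) + σ)
      ((ρ : g →ₗ[ℂ] Matrix (Fin d) (Fin d) ℂ) - σ) = 0) :
    ∃ α : g ≃ₗ⁅ℂ⁆ g, (∀ X, α (α X) = X) ∧ ∀ X, ρ (α X) = σ X := by
  have : Module.Finite ℂ g := Module.Finite.of_basis b
  set F := (ρ : g →ₗ[ℂ] Matrix (Fin d) (Fin d) ℂ) + σ with hF
  set G := (ρ : g →ₗ[ℂ] Matrix (Fin d) (Fin d) ℂ) - σ with hG
  have hFa : ∀ X, F X = ρ X + σ X := fun X => rfl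
  have hGa : ∀ X, G X = ρ X - σ X := fun X => rfl
  have h' : casimirPairing b G F = 0 := by
    rw [← swapLegs_casimirPairing, h]; rfl
  -- A vector Killing-orthogonal to both kernels is killed by `ρ + σ` and, after exchanging the
  -- legs, by `ρ - σ`; hence by `ρ`.
  have htop : LinearMap.ker F ⊔ LinearMap.ker G = ⊤ := by
    by_contra hne
    obtain ⟨f, hf0, hf⟩ := Submodule.exists_le_ker_of_lt_top _ (lt_top_iff_ne_top.2 hne)
    have hnd := LieAlgebra.IsKilling.killingForm_nondegenerate ℂ g
    let X := (LinearMap.BilinForm.toDual (killingForm ℂ g) hnd).symm f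
    have hX : ∀ Y, killingForm ℂ g X Y = f Y := fun Y =>
      LinearMap.BilinForm.apply_toDual_symm_apply (hB := hnd) f Y
    have e1 : F X = 0 := apply_eq_zero_of_casimirPairing_eq_zero b h fun Y hY => by
      rw [hX]; exact hf (Submodule.mem_sup_right (LinearMap.mem_ker.2 hY))
    have e2 : G X = 0 := apply_eq_zero_of_casimirPairing_eq_zero b h' fun Y hY => by
      rw [hX]; exact hf (Submodule.mem_sup_left (LinearMap.mem_ker.2 hY))
    have e3 : ρ X = 0 := by
      have : (2 : ℂ) • ρ X = 0 := by
        rw [← add_zero (0 : Matrix (Fin d) (Fin d) ℂ)]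
        nth_rewrite 1 [← e1]
        rw [← e2, hFa, hGa]
        module
      simpa using this
    have e4 : X = 0 := hρ (by rw [e3, map_zero])
    refine hf0 (LinearMap.ext fun Y => ?_)
    rw [← hX, e4]
    simp
  obtain ⟨l, hl⟩ := LinearMap.exists_leftInverse_of_injective
    (ρ : g →ₗ[ℂ] Matrix (Fin d) (Fin d) ℂ) (LinearMap.ker_eq_bot.2 hρ)
  have hl' : ∀ X, l (ρ X) = X := fun X => LinearMap.congr_fun hl X
  let a : g →ₗ[ℂ] g := l ∘ₗ σ
  have hdec : ∀ X, ∃ y z, X = z + y ∧ σ y = ρ y ∧ σ z = -ρ z := by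
    intro X
    have hX : X ∈ LinearMap.ker F ⊔ LinearMap.ker G := htop ▸ Submodule.mem_top
    obtain ⟨z, hz, y, hy, rfl⟩ := Submodule.mem_sup.1 hX
    exact ⟨y, z, rfl, (sub_eq_zero.1 hy).symm, (neg_eq_of_add_eq_zero_right hz).symm⟩
  have ha : ∀ X, ρ (a X) = σ X := by
    intro X
    obtain ⟨y, z, rfl, hy, hz⟩ := hdec X
    simp only [a, LinearMap.comp_apply, map_add, hy, hz, map_neg, hl']
  have haa : ∀ X, a (a X) = X := by
    intro X
    obtain ⟨y, z, rfl, hy, hz⟩ := hdec X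
    simp only [a, LinearMap.comp_apply, map_add, hy, hz, map_neg, hl', neg_neg]
  refine ⟨{ toFun := a
            map_add' := a.map_add
            map_smul' := a.map_smul
            map_lie' := fun {X Y} => hρ ?_
            invFun := a
            left_inv := haa
            right_inv := haa }, haa, ha⟩
  rw [ha, LieHom.map_lie, LieRing.of_associative_ring_bracket, ha, ha, hσ]

end Involution

/-! ### The reduced equation for commutators and anticommutators -/

section Reduced

variable {g : Type*} [LieRing g] [LieAlgebra ℂ g] {ι : Type*} [Fintype ι] [DecidableEq ι]
  (b : Module.Basis ι ℂ g) {d : ℕ} (ρ : g →ₗ⁅ℂ⁆ Matrix (Fin d) (Fin d) ℂ) (α : g ≃ₗ⁅ℂ⁆ g)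

/-- The commutator with a matrix. -/
noncomputable def commMap (M : Matrix (Fin d) (Fin d) ℂ) : g →ₗ[ℂ] Matrix (Fin d) (Fin d) ℂ :=
  (LinearMap.mulRight ℂ M - LinearMap.mulLeft ℂ M) ∘ₗ (ρ : g →ₗ[ℂ] Matrix (Fin d) (Fin d) ℂ)

/-- The anticommutator with a matrix. -/
noncomputable def antiMap (M : Matrix (Fin d) (Fin d) ℂ) : g →ₗ[ℂ] Matrix (Fin d) (Fin d) ℂ :=
  (LinearMap.mulRight ℂ M + LinearMap.mulLeft ℂ M) ∘ₗ (ρ : g →ₗ[ℂ] Matrix (Fin d) (Fin d) ℂ)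

lemma commMap_apply (M : Matrix (Fin d) (Fin d) ℂ) (X : g) :
    commMap ρ M X = ρ X * M - M * ρ X := rfl

lemma antiMap_apply (M : Matrix (Fin d) (Fin d) ℂ) (X : g) :
    antiMap ρ M X = ρ X * M + M * ρ X := rfl

/-- The consequences of the classical boundary Yang-Baxter equation for `A(u) = κt(u) κ⁻¹` in terms
of the involution determined by the value at infinity. -/
structure IsReducedSolution (D : Set ℂ) (A : ℂ → Matrix (Fin d) (Fin d) ℂ) : Prop where
  eq : ∀ u ∈ D, ∀ v ∈ D, u ≠ v → u ≠ -v →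
    u • casimirPairing b (commMap ρ (A u)) (antiMap ρ (A v))
      + v • casimirPairing b (antiMap ρ (A u)) (commMap ρ (A v)) = 0
  anti : ∀ v ∈ D, ∀ X, commMap ρ (A v) (α X) = -commMap ρ (A v) X
  limit : EqUpToOrder 1 A fun _ => 1
  trace_eq : ∀ u ∈ D, (A u).trace = d

variable {b ρ α}

/-- A Killing isometry that is its own inverse is self-adjoint. -/
lemma casimirPairing_comp_involution [LieAlgebra.IsKilling ℂ g] (hα : ∀ X, α (α X) = X)
    (F G : g →ₗ[ℂ] Matrix (Fin d) (Fin d) ℂ) :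
    casimirPairing b (F ∘ₗ (α : g →ₗ[ℂ] g)) G = casimirPairing b F (G ∘ₗ (α : g →ₗ[ℂ] g)) := by
  have : Module.Finite ℂ g := Module.Finite.of_basis b
  refine casimirPairing_comp_left b _ _ fun X Y => ?_
  have h := LieAlgebra.killingForm_of_equiv_apply α X (α Y)
  rw [hα] at h
  exact h

lemma IsKappaSolution.isReducedSolution [LieAlgebra.IsKilling ℂ g]
    {ρ₂ : g →ₗ⁅ℂ⁆ Matrix (Fin d) (Fin d) ℂ}
    {κ : Matrix (Fin d) (Fin d) ℂ} {D : Set ℂ} {κt : ℂ → Matrix (Fin d) (Fin d) ℂ}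
    (h : IsKappaSolution b ρ ρ₂ κ D κt) (hκ : IsUnit κ) (hD : D ∈ Bornology.cobounded ℂ)
    (hρ : Function.Injective ρ)
    (hα : ∀ X, α (α X) = X) (hσ : ∀ X, ρ (α X) = κ * ρ₂ X * κ⁻¹) :
    IsReducedSolution b ρ α D fun u => κt u * κ⁻¹ := by
  have hσ' : conjMap κ ρ₂ =
      (ρ : g →ₗ[ℂ] Matrix (Fin d) (Fin d) ℂ) ∘ₗ (α : g →ₗ[ℂ] g) := by
    ext1 X
    exact (hσ X).symm
  have hαα : ((ρ : g →ₗ[ℂ] Matrix (Fin d) (Fin d) ℂ) ∘ₗ (α : g →ₗ[ℂ] g)) ∘ₗ (α : g →ₗ[ℂ] g) =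
      (ρ : g →ₗ[ℂ] Matrix (Fin d) (Fin d) ℂ) := by
    ext1 X
    exact congrArg ρ (hα X)
  have hC : casimirPairing b (conjMap κ ρ₂) (conjMap κ ρ₂) = casimirPairing b ρ ρ := by
    rw [hσ', casimirPairing_comp_involution hα, hαα]
  have hC' : casimirPairing b (conjMap κ ρ₂) ρ = casimirPairing b ρ (conjMap κ ρ₂) := by
    rw [hσ', casimirPairing_comp_involution hα]
  have hcomm : ∀ F : g →ₗ[ℂ] Matrix (Fin d) (Fin d) ℂ, ∀ M,
      casimirPairing b F ρ * leg₂ M - leg₂ M * casimirPairing b F ρ =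
        casimirPairing b F (commMap ρ M) := by
    intro F M
    rw [casimirPairing_mul_leg₂, leg₂_mul_casimirPairing, ← casimirPairing_sub_right]
    rfl
  have hcomm₁ : ∀ F : g →ₗ[ℂ] Matrix (Fin d) (Fin d) ℂ, ∀ M,
      casimirPairing b ρ F * leg₁ M - leg₁ M * casimirPairing b ρ F =
        casimirPairing b (commMap ρ M) F := by
    intro F M
    rw [casimirPairing_mul_leg₁, leg₁_mul_casimirPairing, ← casimirPairing_sub_left]
    rfl
  -- With `C` and `P` the Casimir tensors of `(ρ, ρ)` and `(ρ ∘ α, ρ)`, the equation at infinity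
  -- says that `C + P` commutes with the second-leg operator `A(v)`; cancel the faithful leg `ρ`.
  have hanti : ∀ v ∈ D,
      commMap ρ (κt v * κ⁻¹) ∘ₗ (α : g →ₗ[ℂ] g) = -commMap ρ (κt v * κ⁻¹) := by
    intro v hv
    have h0 := h.eq_at_infinity hκ hD hv
    rw [hC, ← hC', hcomm, hcomm, hσ', casimirPairing_comp_involution hα,
      ← casimirPairing_add_right] at h0
    refine eq_neg_of_add_eq_zero_right (casimirPairing_right_injective b hρ (F := ρ) ?_)
    rw [h0]
    simp [casimirPairing]
  refine ⟨fun u hu v hv h1 h2 => ?_, fun v hv X => LinearMap.congr_fun (hanti v hv) X,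
    h.normalized_limit hκ, fun u hu => h.trace_eq u hu⟩
  have h0 := h.normalized_eq hκ hu hv h1 h2
  rw [hC, ← hC'] at h0
  set P := casimirPairing b (conjMap κ ρ₂) ρ with hP
  set C := casimirPairing b (ρ : g →ₗ[ℂ] Matrix (Fin d) (Fin d) ℂ) ρ with hCdef
  set p := leg₁ (κt u * κ⁻¹) with hp
  set q := leg₂ (κt v * κ⁻¹) with hq
  have hpq : p * q = q * p := leg₁_mul_leg₂ _ _
  have hPq : P * q - q * P = -(C * q - q * C) := by
    rw [hP, hq, hcomm, hσ', casimirPairing_comp_involution hα, hanti v hv, hCdef, hcomm,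
      casimirPairing_neg_right]
  have hsub : u - v ≠ 0 := sub_ne_zero.2 h1
  have hadd : u + v ≠ 0 := fun h => h2 (eq_neg_of_add_eq_zero_left h)
  have h3 : (u + v) • (C * p * q - p * q * C) + (u - v) • (p * P * q - q * P * p) = 0 := by
    have := congrArg (fun W => ((u - v) * (u + v)) • W) h0
    simp only [smul_zero, smul_add, smul_smul] at this
    rw [show (u - v) * (u + v) * (1 / (u - v)) = u + v by field_simp,
      show (u - v) * (u + v) * (1 / (u + v)) = u - v by field_simp] at this
    exact this
  -- Moving `P` to the right end trades it for commutators with `C`, and the terms `p q P` cancel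
  -- since `p` and `q` commute.
  have h4 : p * P * q - q * P * p = q * (C * p - p * C) - p * (C * q - q * C) := by
    have hPp : P * p - p * P = -(C * p - p * C) := by
      rw [hC', hcomm₁, hσ', ← casimirPairing_comp_involution hα, hanti u hu,
        casimirPairing_neg_left, hCdef, hcomm₁]
    have e1 : P * q = q * P - (C * q - q * C) := by
      rw [sub_eq_iff_eq_add'.1 hPq]; exact (sub_eq_add_neg _ _).symm
    have e2 : P * p = p * P - (C * p - p * C) := by
      rw [sub_eq_iff_eq_add'.1 hPp]; exact (sub_eq_add_neg _ _).symm
    rw [mul_assoc, mul_assoc q P p, e1, e2]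
    simp only [mul_sub, ← mul_assoc, hpq]
    abel
  have h5 : casimirPairing b (commMap ρ (κt u * κ⁻¹)) (antiMap ρ (κt v * κ⁻¹)) =
      (C * p - p * C) * q + q * (C * p - p * C) := by
    rw [hCdef, hp, hcomm₁, hq, casimirPairing_mul_leg₂, leg₂_mul_casimirPairing,
      ← casimirPairing_add_right]
    rfl
  have h6 : casimirPairing b (antiMap ρ (κt u * κ⁻¹)) (commMap ρ (κt v * κ⁻¹)) =
      (C * q - q * C) * p + p * (C * q - q * C) := by
    rw [hCdef, hq, hcomm, hp, casimirPairing_mul_leg₁, leg₁_mul_casimirPairing,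
      ← casimirPairing_add_left]
    rfl
  rw [h5, h6, ← h3, h4]
  simp only [smul_sub, smul_add, add_smul, sub_smul, mul_sub, sub_mul, mul_assoc, hpq]
  rw [← mul_assoc q p, ← hpq, mul_assoc]
  abel

end Reduced

/-! ### The first-order expansion and the linear equations -/

section Expansion

variable {g : Type*} [LieRing g] [LieAlgebra ℂ g] {ι : Type*} [Fintype ι] [DecidableEq ι]
  {b : Module.Basis ι ℂ g} {d : ℕ} {ρ : g →ₗ⁅ℂ⁆ Matrix (Fin d) (Fin d) ℂ} {α : g ≃ₗ⁅ℂ⁆ g}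
  {D : Set ℂ} {A : ℂ → Matrix (Fin d) (Fin d) ℂ}

lemma EqUpToOrder.congr' {n : ℕ} {M M' N : ℂ → Matrix (Fin d) (Fin d) ℂ}
    (h : EqUpToOrder n M N) (hM : ∀ᶠ u in Bornology.cobounded ℂ, M u = M' u) :
    EqUpToOrder n M' N := fun i j =>
  (h i j).congr' (hM.mono fun u hu => by simp only [hu]) EventuallyEq.rfl

lemma eventually_ne_zero : ∀ᶠ u : ℂ in Bornology.cobounded ℂ, u ≠ 0 :=
  Bornology.isBounded_def.1 (Bornology.isBounded_singleton (x := (0 : ℂ)))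

lemma eqUpToOrder_succ_iff {n : ℕ} {M N : ℂ → Matrix (Fin d) (Fin d) ℂ} :
    EqUpToOrder (n + 1) M N ↔ EqUpToOrder n (fun u => u • M u) (fun u => u • N u) := by
  refine forall_congr' fun i => forall_congr' fun j => ?_
  constructor
  · intro h
    refine ((Asymptotics.isBigO_refl (fun u : ℂ => u) _).mul h).congr'
      (Eventually.of_forall fun u => by simp [mul_sub]) ?_
    filter_upwards [eventually_ne_zero] with u hu
    rw [pow_succ]
    field_simp
  · intro h
    refine ((Asymptotics.isBigO_refl (fun u : ℂ => u⁻¹) _).mul h).congr' ?_ ?_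
    · filter_upwards [eventually_ne_zero] with u hu
      simp only [Matrix.smul_apply, smul_eq_mul]
      field_simp
    · filter_upwards [eventually_ne_zero] with u hu
      rw [pow_succ]
      field_simp

lemma eq_zero_of_eq_neg {M : Matrix (Fin d) (Fin d) ℂ} (h : M = -M) : M = 0 := by
  ext i j
  exact self_eq_neg.1 (congrFun (congrFun h i) j)

/-- The commutator with an element of the representation, as a linear map. -/
noncomputable def commWith (ρ : g →ₗ⁅ℂ⁆ Matrix (Fin d) (Fin d) ℂ) (X : g) :
    Matrix (Fin d) (Fin d) ℂ →ₗ[ℂ] Matrix (Fin d) (Fin d) ℂ :=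
  LinearMap.mulLeft ℂ (ρ X) - LinearMap.mulRight ℂ (ρ X)

lemma commWith_apply (X : g) (M : Matrix (Fin d) (Fin d) ℂ) : commWith ρ X M = commMap ρ M X := rfl

lemma antiMap_add (M N : Matrix (Fin d) (Fin d) ℂ) :
    antiMap ρ (M + N) = antiMap ρ M + antiMap ρ N := by
  ext1 X
  simp only [antiMap_apply, LinearMap.add_apply, mul_add, add_mul]
  abel

lemma antiMap_smul (c : ℂ) (M : Matrix (Fin d) (Fin d) ℂ) :
    antiMap ρ (c • M) = c • antiMap ρ M := by
  ext1 X
  simp only [antiMap_apply, LinearMap.smul_apply, mul_smul_comm, smul_mul_assoc, smul_add]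

/-- At `A = 1` the anticommutator map is `2 ρ`, and injectivity is an open condition. -/
lemma eventually_antiMap_injective (b : Module.Basis ι ℂ g) (hρ : Function.Injective ρ)
    (hA : Tendsto A (Bornology.cobounded ℂ) (𝓝 1)) :
    ∀ᶠ v in Bornology.cobounded ℂ, Function.Injective (antiMap ρ (A v)) := by
  obtain ⟨l, hl⟩ := LinearMap.exists_leftInverse_of_injective
    (ρ : g →ₗ[ℂ] Matrix (Fin d) (Fin d) ℂ) (LinearMap.ker_eq_bot.2 hρ)
  have hl' : ∀ X, l (ρ X) = X := fun X => LinearMap.congr_fun hl X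
  have hcont : Continuous fun N => LinearMap.det (l ∘ₗ antiMap ρ N) := by
    simp only [← LinearMap.det_toMatrix b]
    refine Continuous.matrix_det (continuous_pi fun i => continuous_pi fun j => ?_)
    simp only [LinearMap.toMatrix_apply, LinearMap.comp_apply, antiMap_apply]
    exact ((b.coord i ∘ₗ l).continuous_of_finiteDimensional).comp (by fun_prop)
  have h1 : LinearMap.det (l ∘ₗ antiMap ρ 1) ≠ 0 := by
    have : l ∘ₗ antiMap ρ 1 = (2 : ℂ) • LinearMap.id := by
      ext1 X
      simp [antiMap_apply, hl', two_smul]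
    rw [this, LinearMap.det_smul]
    simp
  filter_upwards [((hcont.tendsto 1).comp hA).eventually_ne h1] with v hv
  have : Function.Injective (l ∘ₗ antiMap ρ (A v)) := by
    have : Module.Finite ℂ g := Module.Finite.of_basis b
    exact ((l ∘ₗ antiMap ρ (A v)).equivOfDetNeZero hv).injective
  exact Function.Injective.of_comp (f := l) this

/-- Fix a large `v` and contract away the injective anticommutator leg: the reduced equation then
expresses `u [ρ(X), A(u)]` as a fixed linear function of `A(u)`, which inherits the error `O(u⁻¹)`.
-/
lemma IsReducedSolution.exists_limit [LieAlgebra.IsKilling ℂ g]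
    (h : IsReducedSolution b ρ α D A) (hρ : Function.Injective ρ)
    (hD : D ∈ Bornology.cobounded ℂ) :
    ∃ T : g →ₗ[ℂ] Matrix (Fin d) (Fin d) ℂ,
      ∀ X, EqUpToOrder 1 (fun u => u • commMap ρ (A u) X) fun _ => T X := by
  obtain ⟨v, hv, hvD⟩ := ((eventually_antiMap_injective b hρ h.limit.tendsto).and hD).exists
  obtain ⟨l, hl⟩ := LinearMap.exists_leftInverse_of_injective _ (LinearMap.ker_eq_bot.2 hv)
  let φ : g → Matrix (Fin d) (Fin d) ℂ →ₗ[ℂ] ℂ := fun X => killingForm ℂ g X ∘ₗ l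
  have hφ : ∀ X Y, φ X (antiMap ρ (A v) Y) = killingForm ℂ g X Y := fun X Y =>
    congrArg (killingForm ℂ g X) (LinearMap.congr_fun hl Y)
  let S : g → Matrix (Fin d) (Fin d) ℂ →ₗ[ℂ] Matrix (Fin d) (Fin d) ℂ := fun X =>
    { toFun := fun N =>
        -(v • contractLeg₂ (φ X) (casimirPairing b (antiMap ρ N) (commMap ρ (A v))))
      map_add' := fun M N => by
        rw [antiMap_add, casimirPairing_add_left, map_add, smul_add, neg_add]
      map_smul' := fun c M => by
        rw [antiMap_smul, casimirPairing_smul_left, map_smul, smul_comm v c, RingHom.id_apply,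
          smul_neg] }
  let T : g →ₗ[ℂ] Matrix (Fin d) (Fin d) ℂ :=
    { toFun := fun X => S X 1
      map_add' := fun X Y => by
        change -(v • contractLeg₂ (φ (X + Y)) _) = -(v • _) + -(v • _)
        have : φ (X + Y) = φ X + φ Y := by simp only [φ, map_add, LinearMap.add_comp]
        rw [this, contractLeg₂_add, smul_add, neg_add]
      map_smul' := fun c X => by
        change -(v • contractLeg₂ (φ (c • X)) _) = c • -(v • _)
        have : φ (c • X) = c • φ X := by simp only [φ, map_smul, LinearMap.smul_comp]
        rw [this, contractLeg₂_smul, smul_comm v c, smul_neg] }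
  refine ⟨T, fun X => (h.limit.map (S X)).congr' ?_⟩
  filter_upwards [eventually_mem_ne hD v] with u ⟨hu, hu1, hu2⟩
  have h0 := congrArg (contractLeg₂ (φ X)) (h.eq u hu v hvD hu1 hu2)
  rw [map_add, map_smul, map_smul, contractLeg₂_casimirPairing_of_eq b (hφ X), map_zero] at h0
  exact (eq_neg_of_add_eq_zero_left h0).symm

/-- The factor `2` appears because the anticommutator with `A(u)` tends to `2 ρ`. -/
lemma IsReducedSolution.eq_of_limit (h : IsReducedSolution b ρ α D A)
    (hD : D ∈ Bornology.cobounded ℂ) {T : g →ₗ[ℂ] Matrix (Fin d) (Fin d) ℂ}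
    (hT : ∀ X, Tendsto (fun u => u • commMap ρ (A u) X) (Bornology.cobounded ℂ) (𝓝 (T X)))
    {v : ℂ} (hv : v ∈ D) :
    casimirPairing b T (antiMap ρ (A v)) + (2 * v) • casimirPairing b ρ (commMap ρ (A v)) = 0 := by
  have h1 := tendsto_casimirPairing b (F := fun u => u • commMap ρ (A u)) hT
    (fun X => tendsto_const_nhds (x := antiMap ρ (A v) X))
  have h2 := tendsto_casimirPairing b (F := fun u => antiMap ρ (A u))
    (F₀ := (2 : ℂ) • (ρ : g →ₗ[ℂ] Matrix (Fin d) (Fin d) ℂ)) (l := Bornology.cobounded ℂ)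
    (fun X => by
      have := (h.limit.tendsto.const_mul (ρ X)).add (h.limit.tendsto.mul_const (ρ X))
      simpa [antiMap_apply, two_smul] using this)
    (fun X => tendsto_const_nhds (x := commMap ρ (A v) X))
  have h3 := tendsto_nhds_unique (h1.add (h2.const_smul v)) (tendsto_const_nhds.congr'
    (f₁ := fun _ => 0) (by
      filter_upwards [eventually_mem_ne hD v] with u ⟨hu, hu1, hu2⟩
      rw [casimirPairing_smul_left]
      exact (h.eq u hu v hv hu1 hu2).symm))
  rwa [casimirPairing_smul_left, smul_smul, mul_comm v 2] at h3

lemma IsReducedSolution.casimirPairing_limit (h : IsReducedSolution b ρ α D A)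
    (hD : D ∈ Bornology.cobounded ℂ) {T : g →ₗ[ℂ] Matrix (Fin d) (Fin d) ℂ}
    (hT : ∀ X, Tendsto (fun u => u • commMap ρ (A u) X) (Bornology.cobounded ℂ) (𝓝 (T X))) :
    casimirPairing b T ρ + casimirPairing b ρ T = 0 := by
  have h1 := tendsto_casimirPairing b (l := Bornology.cobounded ℂ) (G := fun u => antiMap ρ (A u))
    (G₀ := (2 : ℂ) • (ρ : g →ₗ[ℂ] Matrix (Fin d) (Fin d) ℂ))
    (fun X => tendsto_const_nhds (x := T X))
    (fun X => by
      have := (h.limit.tendsto.const_mul (ρ X)).add (h.limit.tendsto.mul_const (ρ X))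
      simpa [antiMap_apply, two_smul] using this)
  have h2 := tendsto_casimirPairing b (G := fun u => u • commMap ρ (A u))
    (fun X => tendsto_const_nhds (x := ρ X)) hT
  have h3 := tendsto_nhds_unique (h1.add (h2.const_smul (2 : ℂ))) (tendsto_const_nhds.congr'
    (f₁ := fun _ => 0) (by
      filter_upwards [hD] with v hv
      have := h.eq_of_limit hD hT hv
      rw [← this, mul_smul]
      congr 2
      exact (casimirPairing_smul_right b _ _ v).symm))
  rw [casimirPairing_smul_right, ← smul_add] at h3
  exact (smul_eq_zero.1 h3).resolve_left two_ne_zero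

lemma IsReducedSolution.limit_involution (h : IsReducedSolution b ρ α D A)
    (hD : D ∈ Bornology.cobounded ℂ) {T : g →ₗ[ℂ] Matrix (Fin d) (Fin d) ℂ}
    (hT : ∀ X, Tendsto (fun u => u • commMap ρ (A u) X) (Bornology.cobounded ℂ) (𝓝 (T X)))
    (X : g) : T (α X) = -T X := by
  refine tendsto_nhds_unique (hT (α X)) ((hT X).neg.congr' ?_)
  filter_upwards [hD] with u hu
  rw [h.anti u hu X, smul_neg]

/-- The residue at infinity is given by a central element of the fixed subalgebra. -/
lemma IsReducedSolution.exists_central [LieAlgebra.IsKilling ℂ g]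
    (h : IsReducedSolution b ρ α D A) (hρ : Function.Injective ρ) (hα : ∀ X, α (α X) = X)
    (hD : D ∈ Bornology.cobounded ℂ) {T : g →ₗ[ℂ] Matrix (Fin d) (Fin d) ℂ}
    (hT : ∀ X, Tendsto (fun u => u • commMap ρ (A u) X) (Bornology.cobounded ℂ) (𝓝 (T X))) :
    ∃ Z, α Z = Z ∧ (∀ y, α y = y → ⁅Z, y⁆ = 0) ∧ ∀ X, T X = ρ ⁅X, Z⁆ := by
  have : Module.Finite ℂ g := Module.Finite.of_basis b
  have hTα : T ∘ₗ (α : g →ₗ[ℂ] g) = -T := LinearMap.ext (h.limit_involution hD hT)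
  have hK := h.casimirPairing_limit hD hT
  have hK' : casimirPairing b T ρ =
      casimirPairing b ((ρ : g →ₗ[ℂ] Matrix (Fin d) (Fin d) ℂ) ∘ₗ (α : g →ₗ[ℂ] g)) T := by
    rw [casimirPairing_comp_involution hα, hTα, casimirPairing_neg_right]
    exact eq_neg_of_add_eq_zero_left hK
  -- Contracting `hK` puts the values of `T` in the image of `ρ`; comparison with `hK'` shows that
  -- the preimages are odd.
  have hY : ∀ X, ∃ Y, T X = ρ Y ∧ α Y = -Y := by
    intro X
    obtain ⟨φ, hφ⟩ := exists_functional_of_injective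
      (G := (ρ : g →ₗ[ℂ] Matrix (Fin d) (Fin d) ℂ)) hρ X
    have h1 := congrArg (contractLeg₂ φ) (eq_neg_of_add_eq_zero_left hK)
    have h2 := congrArg (contractLeg₂ φ) hK'
    rw [contractLeg₂_casimirPairing_of_eq b hφ, map_neg, contractLeg₂_casimirPairing] at h1
    rw [contractLeg₂_casimirPairing_of_eq b hφ, contractLeg₂_casimirPairing] at h2
    set Y := ∑ A, ∑ B, ((killingGram b)⁻¹ A B * φ (T (b B))) • b A
    refine ⟨-Y, by rw [h1, map_neg]; rfl, ?_⟩
    rw [map_neg, neg_neg]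
    refine neg_eq_iff_eq_neg.2 (hρ ?_)
    rw [map_neg]
    exact h2.symm.trans h1
  obtain ⟨l, hl⟩ := LinearMap.exists_leftInverse_of_injective
    (ρ : g →ₗ[ℂ] Matrix (Fin d) (Fin d) ℂ) (LinearMap.ker_eq_bot.2 hρ)
  have hl' : ∀ X, l (ρ X) = X := fun X => LinearMap.congr_fun hl X
  let t : g →ₗ[ℂ] g := l ∘ₗ T
  have ht : ∀ X, ρ (t X) = T X := by
    intro X
    obtain ⟨Y, hY, -⟩ := hY X
    simp only [t, LinearMap.comp_apply, hY, hl']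
  have htα : ∀ X, α (t X) = -t X := by
    intro X
    obtain ⟨Y, hY, hY'⟩ := hY X
    simp only [t, LinearMap.comp_apply, hY, hl', hY']
  -- The Leibniz rule survives the limit, since commutation with `A(u)` is a derivation.
  let δ : LieDerivation ℂ g g :=
    { t with
      leibniz' := by
        intro X Y
        refine hρ ?_
        change ρ (t ⁅X, Y⁆) = ρ (⁅X, t Y⁆ - ⁅Y, t X⁆)
        rw [map_sub, LieHom.map_lie, LieHom.map_lie, ht, ht, ht,
          LieRing.of_associative_ring_bracket, LieRing.of_associative_ring_bracket]
        refine tendsto_nhds_unique (hT ⁅X, Y⁆) ((((hT Y).const_mul (ρ X)).sub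
          ((hT Y).mul_const (ρ X))).sub (((hT X).const_mul (ρ Y)).sub
          ((hT X).mul_const (ρ Y))) |>.congr fun u => ?_)
        simp only [commMap_apply, LieHom.map_lie, LieRing.of_associative_ring_bracket,
          Matrix.mul_smul, Matrix.smul_mul, ← smul_sub]
        congr 1
        noncomm_ring }
  obtain ⟨x, hx⟩ := LieDerivation.IsKilling.exists_eq_ad δ
  have hx' : ∀ X, t X = ⁅x, X⁆ := fun X => by
    have h1 := congrArg (fun f : LieDerivation ℂ g g => f X) hx
    simp only [LieDerivation.ad_apply_apply] at h1
    exact h1.symm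
  -- Both `t ∘ α` and `α ∘ t` equal `-t`, so `α x` and `x` have the same adjoint action.
  have hfix : α x = x := by
    rw [← sub_eq_zero]
    refine eq_zero_of_forall_killingForm_eq_zero fun Y => ?_
    have had : LieAlgebra.ad ℂ g (α x - x) = 0 := by
      refine LinearMap.ext fun X => ?_
      rw [LieAlgebra.ad_apply, sub_lie, LinearMap.zero_apply, sub_eq_zero]
      have h1 : ⁅α x, X⁆ = α ⁅x, α X⁆ := by rw [LieEquiv.map_lie, hα]
      have h2 : t (α X) = -t X := hρ (by
        rw [map_neg, ht, ht]; exact h.limit_involution hD hT X)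
      rw [h1, ← hx', htα, h2, neg_neg, hx']
    rw [killingForm_apply_apply, had, LinearMap.zero_comp, map_zero]
  refine ⟨-x, by rw [map_neg, hfix], fun y hy => ?_, fun X => ?_⟩
  · have h1 := h.limit_involution hD hT y
    rw [hy] at h1
    replace h1 := eq_zero_of_eq_neg h1
    rw [← ht, hx'] at h1
    rw [neg_lie, hρ (h1.trans (map_zero ρ).symm), neg_zero]
  · rw [← ht, hx', lie_neg, lie_skew]

lemma trace_eq_zero_of_isSimple [LieAlgebra.IsSimple ℂ g] (X : g) : (ρ X).trace = 0 := by
  let I : LieIdeal ℂ g :=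
    { LinearMap.ker (Matrix.traceLinearMap (Fin d) ℂ ℂ ∘ₗ
        (ρ : g →ₗ[ℂ] Matrix (Fin d) (Fin d) ℂ)) with
      lie_mem := by
        intro x y _
        change (ρ ⁅x, y⁆).trace = 0
        rw [LieHom.map_lie, LieRing.of_associative_ring_bracket, Matrix.trace_sub,
          Matrix.trace_mul_comm, sub_self] }
  rcases LieAlgebra.IsSimple.eq_bot_or_eq_top (R := ℂ) I with h | h
  · refine absurd ⟨fun x y => ?_⟩ (LieAlgebra.IsSimple.non_abelian (R := ℂ) (L := g))
    have hxy : ⁅x, y⁆ ∈ I := by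
      change (ρ ⁅x, y⁆).trace = 0
      rw [LieHom.map_lie, LieRing.of_associative_ring_bracket, Matrix.trace_sub,
        Matrix.trace_mul_comm, sub_self]
    rwa [h, LieSubmodule.mem_bot] at hxy
  · have hX : X ∈ I := h ▸ LieSubmodule.mem_top X
    exact hX

/-- Traceless matrices are controlled by their commutators with an irreducible representation. -/
lemma eqUpToOrder_zero_of_commMap (b : Module.Basis ι ℂ g) (hirr : IsIrreducibleRep ρ) {n : ℕ}
    {N : ℂ → Matrix (Fin d) (Fin d) ℂ}
    (h : ∀ X, EqUpToOrder n (fun u => commMap ρ (N u) X) fun _ => 0)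
    (ht : ∀ᶠ u in Bornology.cobounded ℂ, (N u).trace = 0) : EqUpToOrder n N fun _ => 0 := by
  -- Injective by Schur's lemma. A linear left inverse recovers a traceless matrix from its
  -- commutators and transfers the error bounds.
  let Ψ : Matrix (Fin d) (Fin d) ℂ →ₗ[ℂ] (ι → Matrix (Fin d) (Fin d) ℂ) × ℂ :=
    (LinearMap.pi fun i => commWith ρ (b i)).prod (Matrix.traceLinearMap (Fin d) ℂ ℂ)
  have hΨ : LinearMap.ker Ψ = ⊥ := by
    refine LinearMap.ker_eq_bot'.2 fun M hM => ?_
    have h1 : commMap ρ M = 0 := b.ext fun i => congrFun (congrArg Prod.fst hM) i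
    exact eq_zero_of_commute_of_trace_eq_zero hirr
      (fun X => sub_eq_zero.1 (LinearMap.congr_fun h1 X)) (congrArg Prod.snd hM)
  obtain ⟨L, hL⟩ := LinearMap.exists_leftInverse_of_injective Ψ hΨ
  let S : ι → Matrix (Fin d) (Fin d) ℂ →ₗ[ℂ] Matrix (Fin d) (Fin d) ℂ := fun i =>
    L ∘ₗ LinearMap.inl ℂ _ _ ∘ₗ LinearMap.single ℂ (fun _ : ι => Matrix (Fin d) (Fin d) ℂ) i
  have hS : ∀ M : Matrix (Fin d) (Fin d) ℂ, M.trace = 0 → ∑ i, S i (commMap ρ M (b i)) = M := by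
    intro M hM
    have h1 : Ψ M = ∑ i, LinearMap.inl ℂ _ ℂ
        (LinearMap.single ℂ (fun _ : ι => Matrix (Fin d) (Fin d) ℂ) i (commMap ρ M (b i))) := by
      rw [← map_sum]
      refine Prod.ext ?_ hM
      change (fun i => commMap ρ M (b i)) = ∑ i, Pi.single i (commMap ρ M (b i))
      exact (Finset.univ_sum_single _).symm
    conv_rhs => rw [← LinearMap.id_apply (R := ℂ) M, ← hL, LinearMap.comp_apply, h1, map_sum]
    rfl
  have h2 : EqUpToOrder n (fun u => ∑ i, S i (commMap ρ (N u) (b i))) fun _ => 0 := by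
    intro k l
    simp only [Matrix.sum_apply, Matrix.zero_apply, sub_zero]
    refine Asymptotics.IsBigO.fun_sum fun i _ => ?_
    simpa using (h (b i)).map (S i) k l
  exact h2.congr' (ht.mono fun u hu => hS _ hu)

/-- The difference of the two sides is traceless on `D`, because `ρ(Z)` is, and its commutators with
`ρ(X)` are `O(u⁻²)`. -/
lemma IsReducedSolution.expansion [LieAlgebra.IsSimple ℂ g] (h : IsReducedSolution b ρ α D A)
    (hirr : IsIrreducibleRep ρ) (hD : D ∈ Bornology.cobounded ℂ) {Z : g}
    (hT : ∀ X, EqUpToOrder 1 (fun u => u • commMap ρ (A u) X) fun _ => ρ ⁅X, Z⁆) :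
    EqUpToOrder 2 A fun u => 1 + u⁻¹ • ρ Z := by
  have key : EqUpToOrder 2 (fun u => A u - (1 + u⁻¹ • ρ Z)) fun _ => 0 := by
    refine eqUpToOrder_zero_of_commMap b hirr (fun X => eqUpToOrder_succ_iff.2 ?_) ?_
    · intro i j
      refine (hT X i j).congr' ?_ EventuallyEq.rfl
      filter_upwards [eventually_ne_zero] with u hu
      have : u • commMap ρ (A u - (1 + u⁻¹ • ρ Z)) X = u • commMap ρ (A u) X - ρ ⁅X, Z⁆ := by
        rw [LieHom.map_lie, LieRing.of_associative_ring_bracket, commMap_apply, commMap_apply]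
        simp only [mul_sub, sub_mul, mul_add, add_mul, mul_one, one_mul, smul_sub, smul_add,
          Matrix.mul_smul, Matrix.smul_mul, smul_inv_smul₀ hu]
        abel
      rw [this, smul_zero, Matrix.sub_apply, Matrix.zero_apply, sub_zero]
    · filter_upwards [hD] with u hu
      rw [Matrix.trace_sub, Matrix.trace_add, h.trace_eq u hu, Matrix.trace_smul,
        trace_eq_zero_of_isSimple, Matrix.trace_one]
      simp
  intro i j
  simpa using key i j

lemma tendsto_smul_commMap_of_expansion {Z' : g} (h : EqUpToOrder 2 A fun u => 1 + u⁻¹ • ρ Z')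
    (X : g) : Tendsto (fun u => u • commMap ρ (A u) X) (Bornology.cobounded ℂ)
      (𝓝 (ρ ⁅X, Z'⁆)) := by
  have h1 := eqUpToOrder_succ_iff.1 (h.map (commWith ρ X))
  refine EqUpToOrder.tendsto fun i j => (h1 i j).congr' ?_ EventuallyEq.rfl
  filter_upwards [eventually_ne_zero] with u hu
  have : u • commWith ρ X (1 + u⁻¹ • ρ Z') = ρ ⁅X, Z'⁆ := by
    rw [LieHom.map_lie, LieRing.of_associative_ring_bracket, commWith_apply, commMap_apply]
    simp only [mul_add, add_mul, mul_one, one_mul, smul_sub, smul_add, Matrix.mul_smul,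
      Matrix.smul_mul, smul_inv_smul₀ hu]
    abel
  rw [this]
  rfl

lemma IsReducedSolution.isTwistedIntertwiner [LieAlgebra.IsKilling ℂ g]
    (h : IsReducedSolution b ρ α D A) (hρ : Function.Injective ρ)
    (hD : D ∈ Bornology.cobounded ℂ) {Z : g}
    (hT : ∀ X, Tendsto (fun u => u • commMap ρ (A u) X) (Bornology.cobounded ℂ) (𝓝 (ρ ⁅X, Z⁆)))
    {v : ℂ} (hv : v ∈ D) : IsTwistedIntertwiner ρ α Z (2 * v) (A v) := by
  let S : g →ₗ[ℂ] g := -(LieAlgebra.ad ℂ g Z : g →ₗ[ℂ] g)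
  have hS : ∀ X, S X = ⁅X, Z⁆ := fun X => lie_skew X Z
  have h1 := h.eq_of_limit (T := (ρ : g →ₗ[ℂ] Matrix (Fin d) (Fin d) ℂ) ∘ₗ S) hD
    (fun X => by simpa [hS] using hT X) hv
  -- Invariance of the Killing form moves `-ad Z` to the other leg as `ad Z`, leaving the faithful
  -- leg `ρ` to cancel.
  rw [casimirPairing_comp_left b S (LieAlgebra.ad ℂ g Z) fun X Y => by
    rw [hS, LieModule.traceForm_apply_lie_apply]; rfl, ← casimirPairing_smul_right,
    ← casimirPairing_add_right] at h1
  have h2 : antiMap ρ (A v) ∘ₗ (LieAlgebra.ad ℂ g Z : g →ₗ[ℂ] g) + (2 * v) • commMap ρ (A v) = 0 :=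
    casimirPairing_right_injective b hρ (F := ρ) (by rw [h1]; simp [casimirPairing])
  refine ⟨fun y hy => ?_, fun a _ => ?_⟩
  · have h3 := h.anti v hv y
    rw [hy] at h3
    exact sub_eq_zero.1 (eq_zero_of_eq_neg h3)
  · have h3 : ρ ⁅Z, a⁆ * A v + A v * ρ ⁅Z, a⁆ + (2 * v) • (ρ a * A v - A v * ρ a) = 0 :=
      LinearMap.congr_fun h2 a
    rw [← sub_eq_zero, ← h3]
    simp only [map_add, map_sub, map_smul, add_mul, mul_sub, Matrix.smul_mul, Matrix.mul_smul,
      smul_sub]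
    abel

end Expansion

/-! ### The centre of the fixed subalgebra is at most a line -/

section Center

variable {g : Type*} [LieRing g] [LieAlgebra ℂ g] {d : ℕ} {α : g ≃ₗ⁅ℂ⁆ g}

lemma mem_center_fixedSubalgebra_iff {X : fixedSubalgebra α} :
    X ∈ LieAlgebra.center ℂ (fixedSubalgebra α) ↔ ∀ y, α y = y → ⁅(X : g), y⁆ = 0 := by
  rw [LieModule.mem_maxTrivSubmodule]
  constructor
  · intro h y hy
    have h1 := congrArg Subtype.val (h ⟨y, hy⟩)
    rw [← lie_skew, neg_eq_zero]
    exact h1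
  · intro h y
    refine Subtype.ext ?_
    change ⁅(y : g), (X : g)⁆ = 0
    rw [← lie_skew, h y y.2, neg_zero]

variable [LieAlgebra.IsSimple ℂ g] [Module.Finite ℂ g]

/-- Over `ℂ` some `Z - c X` is Killing-isotropic, and anisotropy on the centre makes it zero. -/
lemma exists_eq_smul_of_central (hα : ∀ X, α (α X) = X) {X Z : g} (hX : α X = X)
    (hXc : ∀ y, α y = y → ⁅X, y⁆ = 0) (hX0 : X ≠ 0) (hZ : α Z = Z)
    (hZc : ∀ y, α y = y → ⁅Z, y⁆ = 0) : ∃ c : ℂ, Z = c • X := by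
  have hB : killingForm ℂ g X X ≠ 0 := fun h =>
    hX0 (eq_zero_of_killingForm_self_eq_zero hα hX hXc h)
  obtain ⟨c, hc⟩ := exists_quadratic_eq_zero (b := -2 * killingForm ℂ g Z X)
    (c := killingForm ℂ g Z Z) hB (IsAlgClosed.exists_eq_mul_self _)
  refine ⟨c, sub_eq_zero.1 (eq_zero_of_killingForm_self_eq_zero hα (Z := Z - c • X) ?_ ?_ ?_)⟩
  · rw [map_sub, map_smul, hX, hZ]
  · intro y hy
    rw [sub_lie, smul_lie, hXc y hy, hZc y hy, smul_zero, sub_zero]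
  · rw [← hc]
    simp only [map_sub, map_smul, LinearMap.sub_apply, LinearMap.smul_apply, smul_eq_mul,
      LieModule.traceForm_comm ℂ g g X Z]
    ring

/-- A reductive algebra that is not semisimple has a nonzero central element. Its trace norm is a
nonzero multiple of its nonzero Killing norm, so dividing by a square root normalizes it. -/
lemma exists_central_trace_eq_one {ρ : g →ₗ⁅ℂ⁆ Matrix (Fin d) (Fin d) ℂ}
    (hρ : Function.Injective ρ) (hα : ∀ X, α (α X) = X)
    (hred : LieAlgebra.HasCentralRadical ℂ (fixedSubalgebra α))
    (hns : ¬ LieAlgebra.IsSemisimple ℂ (fixedSubalgebra α)) :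
    ∃ X₀ ∈ LieAlgebra.center ℂ (fixedSubalgebra α), (ρ (X₀ : g) * ρ (X₀ : g)).trace = 1 := by
  have hbot : LieAlgebra.center ℂ (fixedSubalgebra α) ≠ ⊥ := by
    intro h
    have : LieAlgebra.HasTrivialRadical ℂ (fixedSubalgebra α) :=
      ⟨by rw [hred.radical_eq_center, h]⟩
    exact hns inferInstance
  obtain ⟨X, hX, hX0⟩ := (Submodule.ne_bot_iff _).1 fun h =>
    hbot ((LieSubmodule.toSubmodule_eq_bot _).1 h)
  obtain ⟨c, hc0, hc⟩ := exists_trace_mul_eq_smul_killingForm ρ hρ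
  have hB : killingForm ℂ g (X : g) X ≠ 0 := fun h => hX0 (Subtype.ext
    (eq_zero_of_killingForm_self_eq_zero hα X.2 (mem_center_fixedSubalgebra_iff.1 hX) h))
  obtain ⟨s, hs⟩ := IsAlgClosed.exists_eq_mul_self (ρ (X : g) * ρ (X : g)).trace
  have hs0 : s ≠ 0 := by
    rintro rfl
    rw [hc, mul_zero] at hs
    exact mul_ne_zero hc0 hB hs
  refine ⟨s⁻¹ • X, Submodule.smul_mem (LieAlgebra.center ℂ (fixedSubalgebra α)).toSubmodule _ hX, ?_⟩
  have : ρ ((s⁻¹ • X : fixedSubalgebra α) : g) = s⁻¹ • ρ (X : g) := map_smul ρ s⁻¹ (X : g)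
  rw [this, Matrix.smul_mul, Matrix.mul_smul, Matrix.trace_smul, Matrix.trace_smul, hs]
  simp only [smul_eq_mul]
  field_simp

lemma exists_eq_smul_of_trace {ρ : g →ₗ⁅ℂ⁆ Matrix (Fin d) (Fin d) ℂ} (hα : ∀ X, α (α X) = X)
    {X₀ : fixedSubalgebra α} (hX₀ : X₀ ∈ LieAlgebra.center ℂ (fixedSubalgebra α))
    (htr : ¬ LieAlgebra.IsSemisimple ℂ (fixedSubalgebra α) →
      (ρ (X₀ : g) * ρ (X₀ : g)).trace = 1)
    {Z : g} (hZ : α Z = Z) (hZc : ∀ y, α y = y → ⁅Z, y⁆ = 0) : ∃ c : ℂ, Z = c • (X₀ : g) := by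
  by_cases hss : LieAlgebra.IsSemisimple ℂ (fixedSubalgebra α)
  · have hmem : (⟨Z, hZ⟩ : fixedSubalgebra α) ∈ LieAlgebra.center ℂ (fixedSubalgebra α) :=
      mem_center_fixedSubalgebra_iff.2 hZc
    rw [LieAlgebra.center_eq_bot, LieSubmodule.mem_bot] at hmem
    refine ⟨0, ?_⟩
    rw [zero_smul]
    exact congrArg Subtype.val hmem
  · refine exists_eq_smul_of_central hα X₀.2 (mem_center_fixedSubalgebra_iff.1 hX₀) ?_ hZ hZc
    intro h0
    have := htr hss
    rw [h0, map_zero, zero_mul, Matrix.trace_zero] at this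
    exact zero_ne_one this

end Center

/-! ### The classification of solutions -/

theorem mainTheorem10 {g : Type*} [LieRing g] [LieAlgebra ℂ g] [LieAlgebra.IsSimple ℂ g]
    {ι : Type*} [Fintype ι] [DecidableEq ι] (b : Module.Basis ι ℂ g)
    {d : ℕ} (ρ₁ ρ₂ : g →ₗ⁅ℂ⁆ Matrix (Fin d) (Fin d) ℂ)
    (hρ₁ : Function.Injective ρ₁) (hρ₂ : Function.Injective ρ₂) (hirr : IsIrreducibleRep ρ₁)
    (κ : Matrix (Fin d) (Fin d) ℂ) (hκ : IsUnit κ)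
    (D : Set ℂ) (hD : D ∈ Bornology.cobounded ℂ) (hD₀ : (0 : ℂ) ∉ D)
    (hex : ∃ κt, IsKappaSolution b ρ₁ ρ₂ κ D κt) :
    ∃ α : g ≃ₗ⁅ℂ⁆ g, (∀ X, α (α X) = X) ∧ (∀ X, ρ₁ (α X) = κ * ρ₂ X * κ⁻¹) ∧
      (LieAlgebra.HasCentralRadical ℂ (fixedSubalgebra α) →
        (¬ LieAlgebra.IsSemisimple ℂ (fixedSubalgebra α) →
          ∃ X₀ ∈ LieAlgebra.center ℂ (fixedSubalgebra α),
            (ρ₁ (X₀ : g) * ρ₁ (X₀ : g)).trace = 1) ∧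
        ∀ X₀ ∈ LieAlgebra.center ℂ (fixedSubalgebra α),
          (¬ LieAlgebra.IsSemisimple ℂ (fixedSubalgebra α) →
            (ρ₁ (X₀ : g) * ρ₁ (X₀ : g)).trace = 1) →
          (∀ κt, IsKappaSolution b ρ₁ ρ₂ κ D κt →
            ∃ a₀ : ℂ, HasKappaExpansion κ (ρ₁ (X₀ : g)) a₀ κt) ∧
          ∀ (a₀ : ℂ) (κt κt' : ℂ → Matrix (Fin d) (Fin d) ℂ),
            IsKappaSolution b ρ₁ ρ₂ κ D κt → HasKappaExpansion κ (ρ₁ (X₀ : g)) a₀ κt →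
            IsKappaSolution b ρ₁ ρ₂ κ D κt' → HasKappaExpansion κ (ρ₁ (X₀ : g)) a₀ κt' →
            ∀ u ∈ D, κt u = κt' u) := by
  have hfin : Module.Finite ℂ g := Module.Finite.of_basis b
  obtain ⟨κt₀, h₀⟩ := hex
  have hdet : IsUnit κ.det := (Matrix.isUnit_iff_isUnit_det κ).1 hκ
  obtain ⟨α, hα, hασ⟩ := exists_involution b ρ₁ hρ₁ (conjMap κ ρ₂) (fun X Y => by
    simp only [conjMap_apply, LieHom.map_lie, LieRing.of_associative_ring_bracket]
    have : ∀ P Q : Matrix (Fin d) (Fin d) ℂ,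
        κ * P * κ⁻¹ * (κ * Q * κ⁻¹) = κ * (P * Q) * κ⁻¹ := by
      intro P Q
      rw [mul_assoc κ Q, mul_assoc (κ * P), ← mul_assoc κ⁻¹, Matrix.nonsing_inv_mul _ hdet, one_mul]
      simp only [mul_assoc]
    rw [this, this, mul_sub, sub_mul]) (h₀.casimirPairing_add_sub hκ hD)
  refine ⟨α, hα, hασ, fun hred => ⟨exists_central_trace_eq_one hρ₁ hα hred, ?_⟩⟩
  intro X₀ hX₀ htr
  have hcancel : ∀ M : Matrix (Fin d) (Fin d) ℂ, M * κ⁻¹ * κ = M := fun M =>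
    Matrix.nonsing_inv_mul_cancel_right _ M hdet
  constructor
  · intro κt h
    have hA := h.isReducedSolution hκ hD hρ₁ hα hασ
    obtain ⟨T, hT⟩ := hA.exists_limit hρ₁ hD
    obtain ⟨Z, hZ, hZc, hTZ⟩ := hA.exists_central hρ₁ hα hD fun X => (hT X).tendsto
    obtain ⟨a₀, rfl⟩ := exists_eq_smul_of_trace hα hX₀ htr hZ hZc
    refine ⟨a₀, ?_⟩
    have h1 := (hA.expansion hirr hD fun X => by simpa only [hTZ] using hT X).map
      (LinearMap.mulRight ℂ κ)
    simp only [LinearMap.mulRight_apply, hcancel, add_mul, one_mul, map_smul, smul_smul,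
      Matrix.smul_mul] at h1
    simpa only [HasKappaExpansion, div_eq_inv_mul] using h1
  · intro a₀ κt κt' h hexp h' hexp' u hu
    -- The prescribed expansion fixes `Z = a₀ X₀`, so both solutions satisfy the same linear
    -- equations at each `u`; their traces are both `d ≠ 0`.
    have key : ∀ κs, IsKappaSolution b ρ₁ ρ₂ κ D κs → HasKappaExpansion κ (ρ₁ (X₀ : g)) a₀ κs →
        IsTwistedIntertwiner ρ₁ α (a₀ • (X₀ : g)) (2 * u) (κs u * κ⁻¹) := by
      intro κs hs hes
      refine (hs.isReducedSolution hκ hD hρ₁ hα hασ).isTwistedIntertwiner hρ₁ hD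
        (tendsto_smul_commMap_of_expansion ?_) hu
      have h1 := EqUpToOrder.map hes (LinearMap.mulRight ℂ κ⁻¹)
      simp only [LinearMap.mulRight_apply, add_mul, Matrix.smul_mul,
        Matrix.mul_nonsing_inv _ hdet, Matrix.mul_nonsing_inv_cancel_right _ _ hdet] at h1
      simpa only [map_smul, smul_smul, div_eq_inv_mul] using h1
    have hZ : α (a₀ • (X₀ : g)) = a₀ • (X₀ : g) := by
      rw [map_smul]; exact congrArg (a₀ • ·) X₀.2
    have hu0 : (2 * u : ℂ) ≠ 0 := mul_ne_zero two_ne_zero fun h0 => hD₀ (h0 ▸ hu)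
    have hd : (d : ℂ) ≠ 0 := Nat.cast_ne_zero.2 hirr.1.ne'
    have h1 := (key κt' h' hexp').unique hirr hα hZ (fun y hy => by
      rw [smul_lie, mem_center_fixedSubalgebra_iff.1 hX₀ y hy, smul_zero]) hu0 (key κt h hexp)
      (by rw [h'.trace_eq u hu]; exact hd) (by rw [h'.trace_eq u hu, h.trace_eq u hu])
    rw [← hcancel (κt u), h1, hcancel]
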